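/- Let $k$ be an algebraically closed field of characteristic $0$, let $G$ be a finite group, and let $\mathcal C=\bigoplus_{g\in G}\mathcal C_g$ be an integral fusion category over $k$ with a faithful $G$-grading (every $\mathcal C_g\neq 0$). Write $\mathcal O(\mathcal C)$ for the set of isomorphism classes of simple objects, $d(X)\in\mathbb Z_{\ge 0}$ for the Frobenius–Perron dimension of $X$, and let $$D=\mathrm{FPdim}(\mathcal C_e)=\sum_{X\in\mathcal O(\mathcal C_e)}d(X)^2,\qquad R_g=\bigoplus_{X\in\mathcal O(\mathcal C_g)}d(X)\,X\quad(g\in G).$$ For an automorphism $\phi$ of an object $X$ put $$\det(\phi)=\prod_{Z\in\mathcal O(\mathcal C)}\det\big(\phi\circ-\,|\,\mathrm{Hom}_{\mathcal C}(Z,X)\big)^{d(Z)}\in k^\times .$$ Then $R_f\otimes R_g\cong D\,R_{fg}$ for all $f,g\in G$. Fix isomorphisms $t_{f,g}:R_f\otimes R_g\to\bigoplus_{i=1}^D R_{fg}$, and use them to identify both ends of the associativity constraint $\alpha_{R_f,R_g,R_h}:(R_f\otimes R_g)\otimes R_h\to R_f\otimes(R_g\otimes R_h)$ with $\bigoplus_{i=1}^D\bigoplus_{j=1}^D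 R_{fgh}$, as follows. The source is identified by $$(R_f\otimes R_g)\otimes R_h\cong\bigoplus_i R_{fg}\otimes R_h\cong\bigoplus_i\bigoplus_j R_{fgh},$$ where $i$ is the index of $t_{f,g}$ and $j$ that of $t_{fg,h}$. The target is identified by $$R_f\otimes(R_g\otimes R_h)\cong\bigoplus_j R_f\otimes R_{gh}\cong\bigoplus_j\bigoplus_i R_{fgh}\cong\bigoplus_i\bigoplus_j R_{fgh},$$ where $j$ is the index of $t_{g,h}$, $i$ is that of $t_{f,gh}$, and the last map exchanges the order of summation. Thus $\alpha_{R_f,R_g,R_h}$ becomes an automorphism of $D^2R_{fgh}$, and we set $$\alpha^{\mathcal C}(f,g,h)=\det(\alpha_{R_f,R_g,R_h})^D\in k^\times .$$ For every choice of the $t_{f,g}$, the function $\alpha^{\mathcal C}$ is a $3$-cocycle on $G$ with values in $k^\times$ (trivial action). Its class in $H^3(G,k^\times)$ does not depend on the choice of the $t_{f,g}$ and is an invariant of the $G$-graded fusion category $\mathcal C$: if $\mathcal C'$ is a $G$-graded fusion category over $k$ and $F:\mathcal C\to\mathcal C'$ is a grading-preserving ($k$-linear) tensor equivalence, then the function $\alpha^{\mathcal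 C'}$, formed in the same way in $\mathcal C'$ (where such isomorphisms $R'_f\otimes R'_g\cong D'R'_{fg}$ exist as well), is a $3$-cocycle cohomologous to $\alpha^{\mathcal C}$. -/

import Mathlib

open CategoryTheory CategoryTheory.Limits CategoryTheory.MonoidalCategory

universe w v u v' u' x

attribute [instance] Abelian.hasFiniteBiproducts

noncomputable section

/-! ## Third cohomology of a group with trivial coefficients -/

namespace GroupH3

variable (G : Type x) [Group G] (M : Type w) [CommGroup M]

/-- The differential from 2-cochains to 3-cochains (trivial action, multiplicative notation). -/
def d₂ : (G → G → M) →* (G → G → G → M) where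
  toFun μ f g h := μ g h * (μ (f * g) h)⁻¹ * μ f (g * h) * (μ f g)⁻¹
  map_one' := by funext f g h; simp
  map_mul' μ ν := by
    funext f g h
    simp only [Pi.mul_apply, mul_inv]
    ac_rfl

/-- The differential from 3-cochains to 4-cochains (trivial action, multiplicative notation). -/
def d₃ : (G → G → G → M) →* (G → G → G → G → M) where
  toFun α f g h i :=
    α g h i * (α (f * g) h i)⁻¹ * α f (g * h) i * (α f g (h * i))⁻¹ * α f g h
  map_one' := by funext f g h i; simp
  map_mul' α β := by
    funext f g h i
    simp only [Pi.mul_apply, mul_inv]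
    ac_rfl

/-- The group of 3-cocycles `Z³(G, M)`. -/
def Z3 : Subgroup (G → G → G → M) := (d₃ G M).ker

/-- The group of 3-coboundaries `B³(G, M)`. -/
def B3 : Subgroup (G → G → G → M) := (d₂ G M).range

/-- The cohomology group `H³(G, M)`: 3-cocycles modulo 3-coboundaries. -/
abbrev H3 : Type (max x w) := Z3 G M ⧸ (B3 G M).subgroupOf (Z3 G M)

variable {G M}

/-- `α` is a 3-cocycle and `c` is its cohomology class. -/
def IsCocycleWithClass (α : G → G → G → M) (c : H3 G M) : Prop :=
  ∃ hα : α ∈ Z3 G M, (QuotientGroup.mk (⟨α, hα⟩ : Z3 G M) : H3 G M) = c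

end GroupH3

/-! ## Fusion categories -/

namespace GradedFusion

section Simple

variable (C : Type u) [Category.{v} C] [HasZeroMorphisms C]

/-- Simple objects up to isomorphism. -/
def simpleSetoid : Setoid {X : C // Simple X} where
  r X Y := Nonempty (X.1 ≅ Y.1)
  iseqv :=
    { refl := fun X => ⟨Iso.refl X.1⟩
      symm := fun ⟨e⟩ => ⟨e.symm⟩
      trans := fun ⟨e⟩ ⟨e'⟩ => ⟨e ≪≫ e'⟩ }

/-- The set `O(C)` of isomorphism classes of simple objects. -/
def SimpleClass : Type u := Quotient (simpleSetoid C)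

variable {C}

/-- A simple object in the given isomorphism class. -/
def SimpleClass.rep (X : SimpleClass C) : C := (Quotient.out X : {X : C // Simple X}).1

end Simple

/-- The `k`-linear abelian rigid monoidal category `C` (with bilinear tensor product) is a fusion
category: it has finite-dimensional Hom spaces, every object is a finite direct sum of simple
objects, there are finitely many simple objects up to isomorphism, and the unit is simple. -/
class IsFusionCategory (k : Type w) [Field k] (C : Type u) [Category.{v} C] [Abelian C]
    [Linear k C] [MonoidalCategory C] [MonoidalPreadditive C] [MonoidalLinear k C]
    [RigidCategory C] : Prop where
  finiteDimensional_hom : ∀ X Y : C, FiniteDimensional k (X ⟶ Y)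
  semisimple : ∀ X : C, ∃ (n : ℕ) (S : Fin n → C), (∀ i, Simple (S i)) ∧ Nonempty (X ≅ ⨁ S)
  finite_simpleClass : Finite (SimpleClass C)
  simple_unit : Simple (𝟙_ C)

section Fusion

variable (k : Type w) [Field k] {C : Type u} [Category.{v} C] [Abelian C]
    [Linear k C] [MonoidalCategory C] [MonoidalPreadditive C] [MonoidalLinear k C]
    [RigidCategory C] [IsFusionCategory k C]

/-- The matrix of left multiplication by `X` on the Grothendieck ring, in the basis of simple
objects: the entry at `(Z, Y)` is the multiplicity `[X ⊗ Y : Z] = dim Hom(Z, X ⊗ Y)`. -/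
def fusionMatrix (X : C) : Matrix (SimpleClass C) (SimpleClass C) ℝ :=
  Matrix.of fun Z Y => (Module.finrank k (Z.rep ⟶ X ⊗ Y.rep) : ℝ)

/-- The Frobenius-Perron dimension of `X`: the largest nonnegative real eigenvalue of the matrix of
left multiplication by `X`. -/
def fpdim (X : C) : ℝ :=
  haveI : Finite (SimpleClass C) := IsFusionCategory.finite_simpleClass k
  letI : Fintype (SimpleClass C) := Fintype.ofFinite _
  sSup {r : ℝ | 0 ≤ r ∧ Module.End.HasEigenvalue (fusionMatrix k X).mulVecLin r}

variable (C) in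
/-- All Frobenius-Perron dimensions are integers. -/
def IsIntegralCategory : Prop := ∀ X : C, ∃ n : ℤ, fpdim k X = n

/-- The Frobenius-Perron dimension as a natural number (meaningful in an integral category). -/
def dim (X : C) : ℕ := ⌊fpdim k X⌋₊

/-- The determinant of an automorphism `φ` of `X`: the product over `Z ∈ O(C)` of
`det (φ ∘ - : Hom(Z, X) → Hom(Z, X)) ^ d(Z)`. -/
def autDet {X : C} (φ : X ≅ X) : kˣ :=
  ∏ᶠ Z : SimpleClass C,
    LinearEquiv.det (Linear.homCongr k (Iso.refl Z.rep) φ) ^ dim k Z.rep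

end Fusion

/-! ## Gradings -/

/-- A grading of `C` by `G`: a degree on simple objects with `deg X * deg Y = deg Z` whenever
`Z` is contained in `X ⊗ Y`. -/
structure Grading (C : Type u) [Category.{v} C] [HasZeroMorphisms C] [MonoidalCategory C]
    (G : Type x) [Group G] where
  deg : SimpleClass C → G
  deg_mul : ∀ (X Y Z : SimpleClass C) (i : Z.rep ⟶ X.rep ⊗ Y.rep), Mono i →
    deg X * deg Y = deg Z

/-- Every component of the grading is nonzero. -/
def Grading.Faithful {C : Type u} [Category.{v} C] [HasZeroMorphisms C] [MonoidalCategory C]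
    {G : Type x} [Group G] (γ : Grading C G) : Prop := Function.Surjective γ.deg

/-- `F` sends every simple object of degree `g` to a (simple) object of degree `g`. -/
def PreservesGrading {C : Type u} [Category.{v} C] [HasZeroMorphisms C] [MonoidalCategory C]
    {C' : Type u'} [Category.{v'} C'] [HasZeroMorphisms C'] [MonoidalCategory C']
    {G : Type x} [Group G] (γ : Grading C G) (γ' : Grading C' G) (F : C ⥤ C') : Prop :=
  ∀ (X : SimpleClass C) (X' : SimpleClass C'), Nonempty (F.obj X.rep ≅ X'.rep) →
    γ'.deg X' = γ.deg X

section Copies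

variable {C : Type u} [Category.{v} C] [Abelian C]

/-- The direct sum `n X` of `n` copies of `X`. -/
abbrev copies (n : ℕ) (X : C) : C := ⨁ fun _ : Fin n => X

/-- Exchange of the two summation indices, `⨁ⱼ ⨁ᵢ X ≅ ⨁ᵢ ⨁ⱼ X`. -/
def copiesSwap (m n : ℕ) (X : C) : copies m (copies n X) ≅ copies n (copies m X) where
  hom := biproduct.lift fun i : Fin n => biproduct.map fun _ : Fin m => biproduct.π _ i
  inv := biproduct.lift fun j : Fin m => biproduct.map fun _ : Fin n => biproduct.π _ j
  hom_inv_id := by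
    apply biproduct.hom_ext; intro j
    apply biproduct.hom_ext; intro i
    simp
  inv_hom_id := by
    apply biproduct.hom_ext; intro j
    apply biproduct.hom_ext; intro i
    simp

end Copies

section Alpha

variable (k : Type w) [Field k] {C : Type u} [Category.{v} C] [Abelian C]
    [Linear k C] [MonoidalCategory C] [MonoidalPreadditive C] [MonoidalLinear k C]
    [RigidCategory C] [IsFusionCategory k C] {G : Type x} [Group G] (γ : Grading C G)

/-- The Frobenius-Perron dimension `D` of the trivial component: the sum of `d(X) ^ 2` over the
simple objects of trivial degree. -/
def trivialDim : ℕ := ∑ᶠ X : {X : SimpleClass C // γ.deg X = 1}, dim k X.1.rep ^ 2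

/-- The homogeneous regular object `R_g`, the direct sum of `d(X) X` over the simple objects `X`
of degree `g`. -/
def regularObj (g : G) : C :=
  haveI : Finite (SimpleClass C) := IsFusionCategory.finite_simpleClass k
  ⨁ fun X : {X : SimpleClass C // γ.deg X = g} => copies (dim k X.1.rep) X.1.rep

/-- A choice of isomorphisms `R_f ⊗ R_g ≅ D R_{fg}`. -/
def Identification : Type (max x v) :=
  ∀ f g : G, regularObj k γ f ⊗ regularObj k γ g ≅ copies (trivialDim k γ) (regularObj k γ (f * g))

variable {k γ} (t : Identification k γ)

/-- The identification `(R_f ⊗ R_g) ⊗ R_h ≅ ⨁ᵢ R_{fg} ⊗ R_h ≅ ⨁ᵢ ⨁ⱼ R_{fgh}`: the outer index `i`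
comes from `t f g` and the inner index `j` from `t (f * g) h`. -/
def Identification.left (f g h : G) :
    (regularObj k γ f ⊗ regularObj k γ g) ⊗ regularObj k γ h ≅
      copies (trivialDim k γ) (copies (trivialDim k γ) (regularObj k γ (f * g * h))) :=
  whiskerRightIso (t f g) (regularObj k γ h) ≪≫
    rightDistributor (fun _ => regularObj k γ (f * g)) (regularObj k γ h) ≪≫
    biproduct.mapIso fun _ => t (f * g) h

/-- The identification `R_f ⊗ (R_g ⊗ R_h) ≅ ⨁ⱼ R_f ⊗ R_{gh} ≅ ⨁ⱼ ⨁ᵢ R_{fgh} ≅ ⨁ᵢ ⨁ⱼ R_{fgh}`: the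
outer index `i` comes from `t f (g * h)` and the inner index `j` from `t g h`. -/
def Identification.right (f g h : G) :
    regularObj k γ f ⊗ (regularObj k γ g ⊗ regularObj k γ h) ≅
      copies (trivialDim k γ) (copies (trivialDim k γ) (regularObj k γ (f * g * h))) :=
  whiskerLeftIso (regularObj k γ f) (t g h) ≪≫
    leftDistributor (regularObj k γ f) (fun _ => regularObj k γ (g * h)) ≪≫
    (biproduct.mapIso fun _ => t f (g * h)) ≪≫
    copiesSwap _ _ _ ≪≫
    eqToIso (by rw [mul_assoc])

/-- The associator `α_{R_f, R_g, R_h}` as an automorphism of `D² R_{fgh}`. -/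
def Identification.assocAut (f g h : G) :
    copies (trivialDim k γ) (copies (trivialDim k γ) (regularObj k γ (f * g * h))) ≅
      copies (trivialDim k γ) (copies (trivialDim k γ) (regularObj k γ (f * g * h))) :=
  (t.left f g h).symm ≪≫
    α_ (regularObj k γ f) (regularObj k γ g) (regularObj k γ h) ≪≫ t.right f g h

/-- The function `α^C(f, g, h) = det(α_{R_f, R_g, R_h}) ^ D`. -/
def Identification.alpha (f g h : G) : kˣ := autDet k (t.assocAut f g h) ^ trivialDim k γ

end Alpha

end GradedFusion

end

open GroupH3 GradedFusion

/-!
# The 3-cocycle of a faithfully graded integral fusion category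

Taking Frobenius-Perron eigenvalues is a ring homomorphism from the Grothendieck ring to `ℝ`
(`exists_fusionMatrix_mulVec_eq`): the left multiplication matrices commute with the symmetric
matrix `Aᵀ A`, where `A` is right multiplication by the sum of all simple objects; `A` has positive
entries by rigidity, so Perron's theorem for symmetric matrices provides a positive vector that is
an eigenvector of every left multiplication. Since simple multiplicities determine an object, the
isomorphism `R_f ⊗ R_g ≅ D R_{fg}` is a count: by duality `[R_f ⊗ Y : Z] = d(Y) [R_{fg} : Z]` for `Y`
simple of degree `g` (`mult_regularObj_tensor_rep`), and comparing dimensions also shows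
`d(R_g) = D` for all `g`, which is where faithfulness enters.

The determinant is controlled by one statement (`autDet_mapIso`): a linear functor `F` that
multiplies the dimensions of simple objects by `n` raises determinants to the `n`-th power. It
follows from the expansion `Hom(A, F X) ≅ ⨁_V Hom(A, F V) ⊗ Hom(V, X)`, natural in `X`
(`expandEquiv`). Applied to tensoring with `R_g`, and to `X ↦ D X`, the power is `D` in both cases.

For the cocycle identity, each of the five parenthesizations of `R_f, R_g, R_h, R_i` is identified
with `D³ R_{fghi}` so that the three summation indices belong to the three tensor signs. Relative to
these identifications every arrow of the pentagon is obtained from one of the automorphisms that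
define `alpha` either by tensoring with some `R_g` or by taking `D` copies, so it has determinant
`alpha`, and the pentagon axiom becomes the cocycle identity (`Identification.alpha_pentagon`).
A change of the identifications multiplies `alpha` by an explicit coboundary
(`Identification.alpha_eq_mul_d₂`), and a tensor equivalence carries identifications in `C` to
identifications in `C'` with the same `alpha` (`Identification.transport_alpha`).
-/

noncomputable section

set_option linter.unusedSectionVars false

/-! ### Positive matrices -/

section PositiveMatrix

open Matrix

variable {ι : Type*} [Fintype ι]

lemma abs_dotProduct_mulVec_abs {M : Matrix ι ι ℝ} (hM : ∀ i j, 0 < M i j) (x : ι → ℝ) :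
    x ⬝ᵥ M *ᵥ x ≤ |x| ⬝ᵥ M *ᵥ |x| := by
  simp only [dotProduct, mulVec, Finset.mul_sum]
  refine Finset.sum_le_sum fun i _ => Finset.sum_le_sum fun j _ => ?_
  calc x i * (M i j * x j) ≤ |x i * (M i j * x j)| := le_abs_self _
    _ = |x| i * (M i j * |x| j) := by
      rw [abs_mul, abs_mul, abs_of_pos (hM i j)]; rfl

lemma abs_dotProduct_abs_self (x : ι → ℝ) : |x| ⬝ᵥ |x| = x ⬝ᵥ x := by
  simp [dotProduct]

/-- The Rayleigh quotient of a real matrix attains its maximum. -/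
lemma exists_isMax_rayleigh [Nonempty ι] (M : Matrix ι ι ℝ) :
    ∃ (c : ℝ) (v : ι → ℝ), v ≠ 0 ∧ v ⬝ᵥ M *ᵥ v = c * (v ⬝ᵥ v) ∧
      ∀ x : ι → ℝ, x ⬝ᵥ M *ᵥ x ≤ c * (x ⬝ᵥ x) := by
  have hpos : ∀ x : ι → ℝ, x ≠ 0 → 0 < x ⬝ᵥ x := fun x hx =>
    lt_of_le_of_ne (by simpa [dotProduct] using Finset.sum_nonneg fun i _ => mul_self_nonneg (x i))
      (fun h => hx (dotProduct_self_eq_zero.mp h.symm))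
  have hne : ∀ x ∈ Metric.sphere (0 : ι → ℝ) 1, x ≠ 0 := by
    rintro x hx rfl
    simp at hx
  obtain ⟨v, hv, hmax⟩ := (isCompact_sphere (0 : ι → ℝ) 1).exists_isMaxOn
    (NormedSpace.sphere_nonempty.mpr zero_le_one)
    (f := fun x => (x ⬝ᵥ M *ᵥ x) / (x ⬝ᵥ x))
    (ContinuousOn.div (by fun_prop) (by fun_prop) fun x hx => (hpos x (hne x hx)).ne')
  have hv0 := hne v hv
  refine ⟨_, v, hv0, (div_mul_cancel₀ _ (hpos v hv0).ne').symm, fun x => ?_⟩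
  by_cases hx : x = 0
  · simp [hx]
  have hxn : ‖x‖ ≠ 0 := norm_ne_zero_iff.mpr hx
  have h := hmax (show ‖x‖⁻¹ • x ∈ Metric.sphere (0 : ι → ℝ) 1 by
    simp [norm_smul, hxn])
  rw [← div_le_iff₀ (hpos x hx)]
  simp only [Set.mem_ofPred_eq, mulVec_smul, dotProduct_smul, smul_dotProduct, smul_eq_mul] at h
  convert! h using 1
  field_simp

/-- A maximizer of the Rayleigh quotient of a symmetric matrix is an eigenvector. -/
lemma mulVec_eq_of_isMax_rayleigh {M : Matrix ι ι ℝ} (hs : M.IsSymm) {c : ℝ}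
    (hc : ∀ x : ι → ℝ, x ⬝ᵥ M *ᵥ x ≤ c * (x ⬝ᵥ x)) {v : ι → ℝ}
    (hv : v ⬝ᵥ M *ᵥ v = c * (v ⬝ᵥ v)) : M *ᵥ v = c • v := by
  classical
  have hq : ∀ x : ι → ℝ, x ⬝ᵥ (c • (1 : Matrix ι ι ℝ) - M) *ᵥ x
      = c * (x ⬝ᵥ x) - x ⬝ᵥ M *ᵥ x := fun x => by
    simp [sub_mulVec, dotProduct_sub, smul_mulVec]
  have hp : (c • (1 : Matrix ι ι ℝ) - M).PosSemidef := by
    refine PosSemidef.of_dotProduct_mulVec_nonneg ?_ fun x => ?_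
    · have : Mᵀ = M := hs
      simp [IsHermitian, conjTranspose_eq_transpose_of_trivial, this]
    · rw [star_trivial, hq]
      linarith [hc x]
  have := (hp.dotProduct_mulVec_zero_iff v).mp (by rw [star_trivial, hq, hv, sub_self])
  rw [sub_mulVec, smul_mulVec, one_mulVec, sub_eq_zero] at this
  exact this.symm

/-- **Perron's theorem for symmetric matrices**: a symmetric matrix with positive entries has
a positive eigenvector whose eigenvalue has one-dimensional eigenspace. -/
theorem exists_pos_eigenvector [Nonempty ι] {M : Matrix ι ι ℝ} (hM : ∀ i j, 0 < M i j)
    (hs : M.IsSymm) :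
    ∃ (c : ℝ) (v : ι → ℝ), (∀ i, 0 < v i) ∧ M *ᵥ v = c • v ∧
      ∀ x : ι → ℝ, M *ᵥ x = c • x → ∃ a : ℝ, x = a • v := by
  obtain ⟨c, v, hv0, hv, hc⟩ := exists_isMax_rayleigh M
  -- The absolute value of a maximizer is again a maximizer, and it is positive.
  have key : ∀ x : ι → ℝ, x ≠ 0 → x ⬝ᵥ M *ᵥ x = c * (x ⬝ᵥ x) →
      M *ᵥ |x| = c • |x| ∧ ∀ i, 0 < |x| i := by
    intro x hx hxe
    have h1 : |x| ⬝ᵥ M *ᵥ |x| = c * (|x| ⬝ᵥ |x|) := by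
      refine le_antisymm (hc _) ?_
      rw [abs_dotProduct_abs_self, ← hxe]
      exact abs_dotProduct_mulVec_abs hM x
    have h2 := mulVec_eq_of_isMax_rayleigh hs hc h1
    refine ⟨h2, fun i => lt_of_le_of_ne (abs_nonneg (x i)) fun h0 => ?_⟩
    obtain ⟨j, hj⟩ := Function.ne_iff.mp hx
    have h3 : 0 < (M *ᵥ |x|) i :=
      Finset.sum_pos' (fun l _ => mul_nonneg (hM i l).le (abs_nonneg (x l)))
        ⟨j, Finset.mem_univ _, mul_pos (hM i j) (abs_pos.mpr hj)⟩
    rw [h2, Pi.smul_apply, ← h0] at h3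
    simp at h3
  obtain ⟨hev, hpos⟩ := key v hv0 hv
  refine ⟨c, |v|, hpos, hev, fun x hx => ?_⟩
  obtain ⟨i⟩ := ‹Nonempty ι›
  refine ⟨x i / |v| i, ?_⟩
  by_contra hne
  have hu : M *ᵥ (x - (x i / |v| i) • |v|) = c • (x - (x i / |v| i) • |v|) := by
    rw [mulVec_sub, mulVec_smul, hx, hev, smul_sub, smul_comm]
  have := (key _ (sub_ne_zero.mpr hne) (by rw [hu, dotProduct_smul, smul_eq_mul])).2 i
  have h0 : (x - (x i / |v| i) • |v|) i = 0 := by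
    simp only [Pi.sub_apply, Pi.smul_apply, smul_eq_mul, div_mul_cancel₀ _ (hpos i).ne', sub_self]
  rw [Pi.abs_apply, h0, abs_zero] at this
  exact this.false

/-- A nonnegative matrix with a positive eigenvector of eigenvalue `r` has `r` as its largest
nonnegative eigenvalue. -/
theorem isGreatest_eigenvalue_of_pos_eigenvector [Nonempty ι] {N : Matrix ι ι ℝ}
    (hN : ∀ i j, 0 ≤ N i j) {v : ι → ℝ} (hv : ∀ i, 0 < v i) {r : ℝ} (h : N *ᵥ v = r • v) :
    IsGreatest {s : ℝ | 0 ≤ s ∧ Module.End.HasEigenvalue N.mulVecLin s} r := by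
  have happ : ∀ i, ∑ j, N i j * v j = r * v i := fun i => congrFun h i
  refine ⟨⟨?_, ?_⟩, ?_⟩
  · obtain ⟨i⟩ := ‹Nonempty ι›
    have := Finset.sum_nonneg fun j (_ : j ∈ Finset.univ) => mul_nonneg (hN i j) (hv j).le
    rw [happ] at this
    exact nonneg_of_mul_nonneg_left this (hv i)
  · refine Module.End.hasEigenvalue_of_hasEigenvector (x := v)
      ⟨Module.End.mem_eigenspace_iff.mpr h, fun h0 => ?_⟩
    obtain ⟨i⟩ := ‹Nonempty ι›
    exact (hv i).ne' (congrFun h0 i)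
  · rintro s ⟨hs0, hs⟩
    obtain ⟨y, hy⟩ := hs.exists_hasEigenvector
    have hye : ∀ i, ∑ j, N i j * y j = s * y i :=
      fun i => congrFun (Module.End.mem_eigenspace_iff.mp hy.1) i
    obtain ⟨i, -, hi⟩ := Finset.exists_max_image Finset.univ (fun i => |y i| / v i)
      Finset.univ_nonempty
    obtain ⟨j, hj⟩ := Function.ne_iff.mp hy.2
    have hyi : 0 < |y i| := by
      have h1 : 0 < |y j| / v j := div_pos (abs_pos.mpr hj) (hv j)
      have h2 := h1.trans_le (hi j (Finset.mem_univ _))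
      exact (div_pos_iff_of_pos_right (hv i)).mp h2
    have hle : s * |y i| ≤ r * |y i| := by
      calc s * |y i| = |∑ j, N i j * y j| := by rw [hye, abs_mul, abs_of_nonneg hs0]
        _ ≤ ∑ j, N i j * (|y i| / v i * v j) := by
          refine (Finset.abs_sum_le_sum_abs _ _).trans (Finset.sum_le_sum fun l _ => ?_)
          rw [abs_mul, abs_of_nonneg (hN i l)]
          refine mul_le_mul_of_nonneg_left ?_ (hN i l)
          rw [← div_le_iff₀ (hv l)]
          exact hi l (Finset.mem_univ _)
        _ = |y i| / v i * ∑ j, N i j * v j := by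
          rw [Finset.mul_sum]
          exact Finset.sum_congr rfl fun _ _ => by ring
        _ = r * |y i| := by
          rw [happ]
          field_simp [(hv i).ne']
    exact le_of_mul_le_mul_right hle hyi

end PositiveMatrix

/-- The determinant of a direct sum of endomorphisms is the product of the determinants. -/
theorem LinearMap.det_piMap {k ι : Type*} [Field k] [Fintype ι] {M : ι → Type*}
    [∀ i, AddCommGroup (M i)] [∀ i, Module k (M i)] [∀ i, FiniteDimensional k (M i)]
    (f : ∀ i, M i →ₗ[k] M i) :
    LinearMap.det (LinearMap.pi fun i => (f i).comp (LinearMap.proj i)) =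
      ∏ i, LinearMap.det (f i) := by
  classical
  let b i := Module.finBasis k (M i)
  let e := Fintype.equivFin ι
  let B := Pi.basis b
  let A := LinearMap.toMatrix B B (LinearMap.pi fun i => (f i).comp (LinearMap.proj i))
  have hA : ∀ p q, A p q = if h : q.1 = p.1 then
      LinearMap.toMatrix (b p.1) (b p.1) (f p.1) p.2 (h ▸ q.2) else 0 := by
    rintro ⟨i, p⟩ ⟨j, q⟩
    by_cases h : j = i
    · subst h
      simp [A, B, LinearMap.toMatrix_apply, Pi.basis_repr, Pi.basis_apply]
    · simp [A, B, LinearMap.toMatrix_apply, Pi.basis_repr, Pi.basis_apply, h]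
  have ht : A.BlockTriangular (fun p => e p.1) := by
    intro p q hpq
    rw [hA, dif_neg]
    intro h
    exact hpq.ne (congrArg e h)
  rw [← LinearMap.det_toMatrix B]
  change A.det = _
  rw [ht.det_fintype, ← e.prod_comp]
  refine Finset.prod_congr rfl fun i _ => ?_
  rw [← LinearMap.det_toMatrix (b i)]
  let s : Fin (Module.finrank k (M i)) ≃
      {p : Σ i, Fin (Module.finrank k (M i)) // e p.1 = e i} :=
    { toFun := fun p => ⟨⟨i, p⟩, rfl⟩
      invFun := fun p => (e.injective p.2) ▸ p.1.2
      left_inv := fun p => rfl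
      right_inv := by
        rintro ⟨⟨j, p⟩, hp⟩
        obtain rfl := e.injective hp
        rfl }
  rw [← Matrix.det_submatrix_equiv_self s]
  congr 1
  ext p q
  simp [s, Matrix.toSquareBlock, Matrix.toSquareBlockProp, hA]

namespace GradedFusion

open Module

/-! ### Simple classes and Hom spaces of direct sums -/

section SimpleClass

variable {C : Type u} [Category.{v} C] [HasZeroMorphisms C]

instance simple_rep (V : SimpleClass C) : Simple V.rep := (Quotient.out V).2

/-- The class of a simple object. -/
def SimpleClass.mk (S : C) [h : Simple S] : SimpleClass C := Quotient.mk (simpleSetoid C) ⟨S, h⟩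

lemma SimpleClass.nonempty_iso_rep (S : C) [h : Simple S] :
    Nonempty (S ≅ (SimpleClass.mk S).rep) :=
  Quotient.exact (s := simpleSetoid C)
    (Quotient.out_eq (Quotient.mk (simpleSetoid C) ⟨S, h⟩)).symm

lemma SimpleClass.eq_of_iso {V W : SimpleClass C} (e : V.rep ≅ W.rep) : V = W := by
  rw [← Quotient.out_eq V, ← Quotient.out_eq W]
  exact Quotient.sound ⟨e⟩

lemma SimpleClass.mk_eq_iff (S : C) [Simple S] (V : SimpleClass C) :
    SimpleClass.mk S = V ↔ Nonempty (S ≅ V.rep) := by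
  obtain ⟨e⟩ := SimpleClass.nonempty_iso_rep S
  exact ⟨fun h => ⟨e ≪≫ eqToIso (by rw [h])⟩, fun ⟨e'⟩ => SimpleClass.eq_of_iso (e.symm ≪≫ e')⟩

end SimpleClass

section Biproduct

variable (k : Type w) [Field k] {C : Type u} [Category.{v} C] [Preadditive C] [Linear k C]

lemma finrank_hom_congr {X X' Y Y' : C} (e : X ≅ X') (f : Y ≅ Y') :
    finrank k (X ⟶ Y) = finrank k (X' ⟶ Y') :=
  (Linear.homCongr k e f).finrank_eq

/-- Morphisms into a direct sum are families of morphisms. -/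
def homBiproductEquiv {J : Type*} (A : C) (X : J → C) [HasBiproduct X] :
    (A ⟶ ⨁ X) ≃ₗ[k] ((j : J) → (A ⟶ X j)) where
  toFun f j := f ≫ biproduct.π X j
  invFun f := biproduct.lift f
  map_add' f g := by ext; simp
  map_smul' r f := by ext; simp
  left_inv f := by apply biproduct.hom_ext; simp
  right_inv f := by ext; simp

/-- Morphisms out of a direct sum are families of morphisms. -/
def biproductHomEquiv {J : Type*} (A : C) (X : J → C) [HasBiproduct X] :
    (⨁ X ⟶ A) ≃ₗ[k] ((j : J) → (X j ⟶ A)) where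
  toFun f j := biproduct.ι X j ≫ f
  invFun f := biproduct.desc f
  map_add' f g := by ext; simp
  map_smul' r f := by ext; simp
  left_inv f := by apply biproduct.hom_ext'; simp
  right_inv f := by ext; simp

variable [∀ X Y : C, FiniteDimensional k (X ⟶ Y)]

lemma finrank_hom_biproduct {J : Type*} [Fintype J] (A : C) (X : J → C) [HasBiproduct X] :
    finrank k (A ⟶ ⨁ X) = ∑ j, finrank k (A ⟶ X j) := by
  rw [(homBiproductEquiv k A X).finrank_eq, finrank_pi_fintype]

lemma finrank_biproduct_hom {J : Type*} [Fintype J] (A : C) (X : J → C) [HasBiproduct X] :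
    finrank k (⨁ X ⟶ A) = ∑ j, finrank k (X j ⟶ A) := by
  rw [(biproductHomEquiv k A X).finrank_eq, finrank_pi_fintype]

end Biproduct

/-! ### Multiplicities in a semisimple category -/

section Semisimple

variable (k : Type w) [Field k] {C : Type u} [Category.{v} C] [Abelian C]
    [Linear k C] [MonoidalCategory C] [MonoidalPreadditive C] [MonoidalLinear k C]
    [RigidCategory C] [IsFusionCategory k C]

instance finiteDimensional_hom (X Y : C) : FiniteDimensional k (X ⟶ Y) :=
  IsFusionCategory.finiteDimensional_hom X Y

/-- The multiplicity of the simple class `Z` in the object `X`. -/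
abbrev mult (Z : SimpleClass C) (X : C) : ℕ := finrank k (Z.rep ⟶ X)

variable [IsAlgClosed k]

open scoped Classical in
lemma mult_simple (Z : SimpleClass C) (S : C) [Simple S] :
    mult k Z S = if SimpleClass.mk S = Z then 1 else 0 := by
  rw [mult, finrank_hom_simple_simple, SimpleClass.mk_eq_iff]
  exact if_congr ⟨fun ⟨e⟩ => ⟨e.symm⟩, fun ⟨e⟩ => ⟨e.symm⟩⟩ rfl rfl

open scoped Classical in
lemma mult_rep (Z V : SimpleClass C) : mult k Z V.rep = if V = Z then 1 else 0 := by
  rw [mult_simple]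
  exact if_congr ((SimpleClass.mk_eq_iff _ _).trans
    ⟨fun ⟨e⟩ => SimpleClass.eq_of_iso e, fun h => ⟨eqToIso (by rw [h])⟩⟩) rfl rfl

lemma finrank_hom_rep_comm (Z : SimpleClass C) (X : C) :
    finrank k (X ⟶ Z.rep) = mult k Z X := by
  obtain ⟨n, S, hS, ⟨e⟩⟩ := IsFusionCategory.semisimple k X
  rw [finrank_hom_congr k e (Iso.refl _), mult, finrank_hom_congr k (Iso.refl _) e,
    finrank_biproduct_hom, finrank_hom_biproduct]
  refine Finset.sum_congr rfl fun i _ => ?_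
  have := hS i
  classical
  rw [finrank_hom_simple_simple, finrank_hom_simple_simple]
  exact if_congr ⟨fun ⟨e⟩ => ⟨e.symm⟩, fun ⟨e⟩ => ⟨e.symm⟩⟩ rfl rfl

/-- Objects of a fusion category with the same multiplicities are isomorphic. -/
theorem nonempty_iso_of_mult_eq {X Y : C} (h : ∀ Z, mult k Z X = mult k Z Y) :
    Nonempty (X ≅ Y) := by
  classical
  obtain ⟨n, S, hS, ⟨e⟩⟩ := IsFusionCategory.semisimple k X
  obtain ⟨m, T, hT, ⟨e'⟩⟩ := IsFusionCategory.semisimple k Y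
  have hcard : ∀ Z : SimpleClass C,
      Nonempty ({i : Fin n // @SimpleClass.mk _ _ _ (S i) (hS i) = Z} ≃
        {j : Fin m // @SimpleClass.mk _ _ _ (T j) (hT j) = Z}) := by
    intro Z
    refine ⟨Fintype.equivOfCardEq ?_⟩
    have := h Z
    rw [mult, mult, finrank_hom_congr k (Iso.refl _) e, finrank_hom_congr k (Iso.refl _) e',
      finrank_hom_biproduct, finrank_hom_biproduct] at this
    rw [Fintype.card_subtype, Fintype.card_subtype, Finset.card_filter, Finset.card_filter]
    refine (Finset.sum_congr rfl fun i _ => ?_).trans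
      (this.trans (Finset.sum_congr rfl fun j _ => ?_))
    · have := hS i
      exact (mult_simple k Z (S i)).symm
    · have := hT j
      exact mult_simple k Z (T j)
  let s := fun Z => (hcard Z).some
  let σ : Fin n ≃ Fin m :=
    ((Equiv.sigmaFiberEquiv fun i => @SimpleClass.mk _ _ _ (S i) (hS i)).symm.trans
      (Equiv.sigmaCongrRight s)).trans
      (Equiv.sigmaFiberEquiv fun j => @SimpleClass.mk _ _ _ (T j) (hT j))
  have hσ : ∀ i, Nonempty (T (σ i) ≅ S i) := by
    intro i
    have := hS i
    have := hT (σ i)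
    have h1 : SimpleClass.mk (T (σ i)) = SimpleClass.mk (S i) := (s _ ⟨i, rfl⟩).2
    obtain ⟨f⟩ := (SimpleClass.mk_eq_iff _ _).mp h1
    obtain ⟨g⟩ := SimpleClass.nonempty_iso_rep (S i)
    exact ⟨f ≪≫ g.symm⟩
  exact ⟨e ≪≫ biproduct.whiskerEquiv σ (fun i => (hσ i).some) ≪≫ e'.symm⟩

section Expand

variable [Fintype (SimpleClass C)] {E : Type u'} [Category.{v'} E] [Preadditive E] [Linear k E]
    [∀ X Y : E, FiniteDimensional k (X ⟶ Y)] (F : C ⥤ E) [F.Additive] [F.Linear k] (A : E)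

omit [IsAlgClosed k] in
/-- Every morphism `A ⟶ F X` is expanded through the spaces `A ⟶ F V` with `V` simple, in a basis
of each of these spaces. The expansion is natural in `X`. -/
def expand (X : C) :
    ((V : SimpleClass C) → Fin (finrank k (A ⟶ F.obj V.rep)) → (V.rep ⟶ X)) →ₗ[k]
      (A ⟶ F.obj X) where
  toFun f := ∑ V, ∑ i, finBasis k (A ⟶ F.obj V.rep) i ≫ F.map (f V i)
  map_add' f g := by simp [Finset.sum_add_distrib]
  map_smul' r f := by simp [Finset.smul_sum]

lemma expand_apply (X : C)
    (f : (V : SimpleClass C) → Fin (finrank k (A ⟶ F.obj V.rep)) → (V.rep ⟶ X)) :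
    expand k F A X f = ∑ V, ∑ i, finBasis k (A ⟶ F.obj V.rep) i ≫ F.map (f V i) := rfl

lemma expand_comp {X Y : C} (g : X ⟶ Y)
    (f : (V : SimpleClass C) → Fin (finrank k (A ⟶ F.obj V.rep)) → (V.rep ⟶ X)) :
    expand k F A Y (fun V i => f V i ≫ g) = expand k F A X f ≫ F.map g := by
  simp [expand_apply, Preadditive.sum_comp]

lemma expand_surjective_of_simple (S : C) [Simple S] :
    Function.Surjective (expand k F A S) := by
  classical
  intro t
  obtain ⟨e⟩ := SimpleClass.nonempty_iso_rep S
  refine ⟨fun V i => if h : V = SimpleClass.mk S then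
    (finBasis k (A ⟶ F.obj (SimpleClass.mk S).rep)).repr (t ≫ F.map e.hom)
      (Fin.cast (by rw [h]) i) • (eqToHom (by rw [h]) ≫ e.inv) else 0, ?_⟩
  rw [expand_apply, Finset.sum_eq_single (SimpleClass.mk S)]
  · simp only [↓reduceDIte, eqToHom_refl, Category.id_comp, Functor.map_smul, Linear.comp_smul,
      Fin.cast_eq_self]
    calc _ = (∑ i, (finBasis k (A ⟶ F.obj (SimpleClass.mk S).rep)).repr (t ≫ F.map e.hom) i •
          finBasis k (A ⟶ F.obj (SimpleClass.mk S).rep) i) ≫ F.map e.inv := by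
          rw [Preadditive.sum_comp]
          exact Finset.sum_congr rfl fun i _ => by simp
      _ = t := by
        rw [Basis.sum_repr, Category.assoc, ← F.map_comp, e.hom_inv_id, F.map_id,
          Category.comp_id]
  · intro V _ hV
    simp [hV]
  · simp

/-- Injectivity follows from surjectivity: by Schur's lemma both spaces have the same dimension. -/
lemma expand_injective_of_simple (S : C) [Simple S] :
    Function.Injective (expand k F A S) := by
  classical
  refine (LinearMap.injective_iff_surjective_of_finrank_eq_finrank ?_).mpr
    (expand_surjective_of_simple k F A S)
  rw [finrank_pi_fintype]
  simp_rw [finrank_pi_fintype]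
  obtain ⟨e⟩ := SimpleClass.nonempty_iso_rep S
  rw [Finset.sum_eq_single (SimpleClass.mk S)]
  · simp [← mult.eq_1, mult_simple]
    exact finrank_hom_congr k (Iso.refl _) (F.mapIso e.symm)
  · intro V _ hV
    simp [← mult.eq_1, mult_simple, hV.symm]
  · simp

lemma expand_bijective (X : C) : Function.Bijective (expand k F A X) := by
  obtain ⟨n, S, hS, ⟨e⟩⟩ := IsFusionCategory.semisimple k X
  have htot : ∑ i, (e.hom ≫ biproduct.π S i) ≫ (biproduct.ι S i ≫ e.inv) = 𝟙 X := by
    calc _ = e.hom ≫ (∑ i, biproduct.π S i ≫ biproduct.ι S i) ≫ e.inv := by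
          simp only [Preadditive.sum_comp, Preadditive.comp_sum, Category.assoc]
      _ = 𝟙 X := by rw [biproduct.total, Category.id_comp, e.hom_inv_id]
  constructor
  · rw [injective_iff_map_eq_zero]
    intro f hf
    have h : ∀ j, (fun V i => f V i ≫ (e.hom ≫ biproduct.π S j)) = 0 := fun j => by
      have := hS j
      apply expand_injective_of_simple k F A (S j)
      rw [expand_comp, hf, zero_comp, map_zero]
    funext V i
    rw [← Category.comp_id (f V i), ← htot, Preadditive.comp_sum]
    refine Finset.sum_eq_zero fun j _ => ?_
    rw [← Category.assoc, congrFun (congrFun (h j) V) i]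
    simp
  · intro t
    have := fun j => hS j
    choose g hg using fun j => expand_surjective_of_simple k F A (S j)
      (t ≫ F.map (e.hom ≫ biproduct.π S j))
    refine ⟨∑ j, fun V i => g j V i ≫ (biproduct.ι S j ≫ e.inv), ?_⟩
    rw [map_sum]
    simp_rw [expand_comp, hg, Category.assoc t, ← F.map_comp]
    rw [← Preadditive.comp_sum, ← F.map_sum, htot, F.map_id, Category.comp_id]

/-- The expansion of morphisms into `F X` as a linear equivalence. -/
def expandEquiv (X : C) :
    ((V : SimpleClass C) → Fin (finrank k (A ⟶ F.obj V.rep)) → (V.rep ⟶ X)) ≃ₗ[k]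
      (A ⟶ F.obj X) :=
  LinearEquiv.ofBijective (expand k F A X) (expand_bijective k F A X)

theorem finrank_hom_map_obj (X : C) :
    finrank k (A ⟶ F.obj X) = ∑ V, finrank k (A ⟶ F.obj V.rep) * mult k V X := by
  rw [← (expandEquiv k F A X).finrank_eq, finrank_pi_fintype]
  simp [finrank_pi_fintype]

/-- The determinant of `F φ` on `Hom(A, F X)` is computed from the determinants of `φ` on
the spaces `Hom(V, X)` with `V` simple. -/
theorem det_homCongr_mapIso {X : C} (φ : X ≅ X) :
    LinearEquiv.det (Linear.homCongr k (Iso.refl A) (F.mapIso φ)) =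
      ∏ V : SimpleClass C, LinearEquiv.det (Linear.homCongr k (Iso.refl V.rep) φ) ^
        finrank k (A ⟶ F.obj V.rep) := by
  apply Units.ext
  rw [Units.coe_prod, LinearEquiv.coe_det,
    ← LinearMap.det_conj _ (expandEquiv k F A X).symm]
  simp only [Units.val_pow_eq_pow_val, LinearEquiv.coe_det]
  have h1 : ∀ V : SimpleClass C, LinearMap.det
      ((Linear.homCongr k (Iso.refl V.rep) φ : (V.rep ⟶ X) ≃ₗ[k] _) : (V.rep ⟶ X) →ₗ[k] _) ^
        finrank k (A ⟶ F.obj V.rep) =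
      LinearMap.det (LinearMap.pi fun i : Fin (finrank k (A ⟶ F.obj V.rep)) =>
        ((Linear.homCongr k (Iso.refl V.rep) φ : (V.rep ⟶ X) ≃ₗ[k] _) :
          (V.rep ⟶ X) →ₗ[k] _).comp (LinearMap.proj i)) := fun V => by
    rw [LinearMap.det_pi]
    simp
  simp_rw [h1]
  rw [← LinearMap.det_piMap]
  congr 1
  refine LinearMap.ext fun f => ?_
  apply (expandEquiv k F A X).injective
  simp only [LinearMap.comp_apply, LinearEquiv.coe_coe, LinearEquiv.symm_symm,
    LinearEquiv.apply_symm_apply]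
  refine (Eq.trans ?_ (expand_comp k F A φ.hom f).symm).trans ?_
  · simp [Linear.homCongr_apply, expandEquiv]
  · refine congrArg (expand k F A X) ?_
    funext V i
    simp [Linear.homCongr_apply]

end Expand

end Semisimple

/-! ### Frobenius-Perron dimensions -/

section FrobeniusPerron

open Matrix

variable (k : Type w) [Field k] {C : Type u} [Category.{v} C] [Abelian C]
    [Linear k C] [MonoidalCategory C] [MonoidalPreadditive C] [MonoidalLinear k C]
    [RigidCategory C] [IsFusionCategory k C]

lemma finrank_tensorLeft_hom (X Y Y' Z : C) [ExactPairing Y Y'] :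
    finrank k (Y' ⊗ X ⟶ Z) = finrank k (X ⟶ Y ⊗ Z) :=
  LinearEquiv.finrank_eq
    { tensorLeftHomEquiv X Y Y' Z with
      map_add' := fun f g => by simp [tensorLeftHomEquiv]
      map_smul' := fun r f => by simp [tensorLeftHomEquiv] }

lemma finrank_tensorRight_hom (X Y Y' Z : C) [ExactPairing Y Y'] :
    finrank k (X ⊗ Y ⟶ Z) = finrank k (X ⟶ Z ⊗ Y') :=
  LinearEquiv.finrank_eq
    { tensorRightHomEquiv X Y Y' Z with
      map_add' := fun f g => by simp [tensorRightHomEquiv]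
      map_smul' := fun r f => by simp [tensorRightHomEquiv] }

lemma fusionMatrix_apply (X : C) (Z Y : SimpleClass C) :
    fusionMatrix k X Z Y = mult k Z (X ⊗ Y.rep) := rfl

/-- The class of the unit object. -/
def unitClass : SimpleClass C :=
  haveI := IsFusionCategory.simple_unit k (C := C)
  SimpleClass.mk (𝟙_ C)

lemma nonempty_unit_iso : Nonempty (𝟙_ C ≅ (unitClass k (C := C)).rep) :=
  haveI := IsFusionCategory.simple_unit k (C := C)
  SimpleClass.nonempty_iso_rep (𝟙_ C)

lemma fpdim_eq_sSup [Fintype (SimpleClass C)] (X : C) :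
    fpdim k X = sSup {r : ℝ | 0 ≤ r ∧ End.HasEigenvalue (fusionMatrix k X).mulVecLin r} := by
  unfold fpdim
  congr!

lemma mult_congr (Z : SimpleClass C) {X Y : C} (e : X ≅ Y) : mult k Z X = mult k Z Y :=
  finrank_hom_congr k (Iso.refl _) e

lemma fpdim_congr {X Y : C} (e : X ≅ Y) : fpdim k X = fpdim k Y := by
  have : fusionMatrix k X = fusionMatrix k Y := by
    ext Z V
    rw [fusionMatrix_apply, fusionMatrix_apply, mult_congr k Z (whiskerRightIso e V.rep)]
  unfold fpdim
  rw [this]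

lemma dim_congr {X Y : C} (e : X ≅ Y) : dim k X = dim k Y := by
  rw [dim, dim, fpdim_congr k e]

variable [IsAlgClosed k]

lemma mult_leftDual_tensor (Y : C) (Z W : SimpleClass C) :
    mult k Z ((ᘁY) ⊗ W.rep) = mult k W (Y ⊗ Z.rep) := by
  rw [mult, ← finrank_tensorLeft_hom k Z.rep (ᘁY) Y, finrank_hom_rep_comm]

variable [Fintype (SimpleClass C)]

lemma mult_tensor_left (Z : SimpleClass C) (X Y : C) :
    mult k Z (X ⊗ Y) = ∑ V : SimpleClass C, mult k Z (X ⊗ V.rep) * mult k V Y :=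
  finrank_hom_map_obj k (tensorLeft X) Z.rep Y

lemma mult_tensor_right (Z : SimpleClass C) (X Y : C) :
    mult k Z (X ⊗ Y) = ∑ V : SimpleClass C, mult k Z (V.rep ⊗ Y) * mult k V X :=
  finrank_hom_map_obj k (tensorRight Y) Z.rep X

lemma mult_self (V : SimpleClass C) : mult k V V.rep = 1 := by
  classical
  rw [mult_rep, if_pos rfl]

/-- The matrix of right multiplication by the direct sum of all simple objects. -/
def rightFusionMatrix : Matrix (SimpleClass C) (SimpleClass C) ℝ :=
  Matrix.of fun Z X => ∑ Y : SimpleClass C, (mult k Z (X.rep ⊗ Y.rep) : ℝ)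

lemma mult_unit_tensor_dual_pos (X : SimpleClass C) :
    0 < mult k (unitClass k) (X.rep ⊗ X.repᘁ) := by
  obtain ⟨e⟩ := nonempty_unit_iso k (C := C)
  rw [mult, ← finrank_hom_congr k e (Iso.refl _), ← finrank_tensorRight_hom k (𝟙_ C) X.rep,
    finrank_hom_congr k (λ_ X.rep) (Iso.refl _)]
  exact Nat.lt_of_lt_of_eq Nat.one_pos (mult_self k X).symm

lemma exists_mult_tensor_pos (Z X : SimpleClass C) :
    ∃ Y : SimpleClass C, 0 < mult k Z (X.rep ⊗ Y.rep) := by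
  -- `X ⊗ Xᘁ` contains the unit, so `X ⊗ (Xᘁ ⊗ Z)` contains `Z`.
  have h : 0 < mult k Z (X.rep ⊗ (X.repᘁ ⊗ Z.rep)) := by
    rw [← mult_congr k Z (α_ _ _ _), mult_tensor_right]
    refine Finset.sum_pos' (fun _ _ => Nat.zero_le _) ⟨unitClass k, Finset.mem_univ _, ?_⟩
    refine Nat.mul_pos ?_ (mult_unit_tensor_dual_pos k X)
    obtain ⟨e⟩ := nonempty_unit_iso k (C := C)
    rw [← mult_congr k Z (whiskerRightIso e _), mult_congr k Z (λ_ _), mult_self]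
    exact Nat.one_pos
  rw [mult_tensor_left] at h
  obtain ⟨Y, -, hY⟩ := Finset.exists_ne_zero_of_sum_ne_zero h.ne'
  exact ⟨Y, Nat.pos_of_ne_zero (left_ne_zero_of_mul hY)⟩

lemma rightFusionMatrix_pos (Z X : SimpleClass C) : 0 < rightFusionMatrix k Z X := by
  obtain ⟨Y, hY⟩ := exists_mult_tensor_pos k Z X
  exact Finset.sum_pos' (fun _ _ => Nat.cast_nonneg _) ⟨Y, Finset.mem_univ _, Nat.cast_pos.mpr hY⟩

/-- Left and right multiplications commute. -/
lemma fusionMatrix_mul_rightFusionMatrix (X : C) :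
    fusionMatrix k X * rightFusionMatrix k = rightFusionMatrix k * fusionMatrix k X := by
  ext Z W
  simp only [mul_apply, fusionMatrix_apply, rightFusionMatrix, of_apply, Finset.mul_sum,
    Finset.sum_mul]
  rw [Finset.sum_comm]
  conv_rhs => rw [Finset.sum_comm]
  refine Finset.sum_congr rfl fun Y _ => ?_
  have h := (mult_congr k Z (α_ X W.rep Y.rep)).symm
  rw [mult_tensor_left, mult_tensor_right] at h
  exact_mod_cast h

lemma fusionMatrix_leftDual (X : C) : fusionMatrix k (ᘁX) = (fusionMatrix k X)ᵀ := by
  ext Z W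
  rw [transpose_apply, fusionMatrix_apply, fusionMatrix_apply, mult_leftDual_tensor k X Z W]

/-- The regular representation of the Grothendieck ring has a positive vector that is a common
eigenvector of all left multiplications; the eigenvalues are the Frobenius-Perron dimensions. -/
theorem exists_fusionMatrix_mulVec_eq :
    ∃ v : SimpleClass C → ℝ, (∀ Z, 0 < v Z) ∧ ∀ X : C, fusionMatrix k X *ᵥ v = fpdim k X • v := by
  have : Nonempty (SimpleClass C) := ⟨unitClass k⟩
  set A := rightFusionMatrix k (C := C) with hA
  have hpos : ∀ i j, 0 < (Aᵀ * A) i j := fun i j =>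
    Finset.sum_pos (fun l _ => mul_pos (rightFusionMatrix_pos k l i) (rightFusionMatrix_pos k l j))
      Finset.univ_nonempty
  -- The symmetric matrix `Aᵀ * A` commutes with left multiplications, since their transposes are
  -- left multiplications as well.
  have hcomm : ∀ X : C, fusionMatrix k X * (Aᵀ * A) = Aᵀ * A * fusionMatrix k X := by
    intro X
    have h1 : fusionMatrix k X * Aᵀ = Aᵀ * fusionMatrix k X := by
      have := congrArg transpose (fusionMatrix_mul_rightFusionMatrix k (ᘁX))
      rw [transpose_mul, transpose_mul, fusionMatrix_leftDual, transpose_transpose] at this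
      exact this.symm
    rw [← Matrix.mul_assoc, h1, Matrix.mul_assoc, fusionMatrix_mul_rightFusionMatrix,
      Matrix.mul_assoc]
  obtain ⟨c, v, hv, hvc, huniq⟩ := exists_pos_eigenvector hpos
    (by rw [IsSymm, transpose_mul, transpose_transpose])
  refine ⟨v, hv, fun X => ?_⟩
  obtain ⟨r, hr⟩ := huniq (fusionMatrix k X *ᵥ v) (by
    rw [mulVec_mulVec, ← hcomm, ← mulVec_mulVec, hvc, mulVec_smul])
  rw [hr, fpdim_eq_sSup,
    (isGreatest_eigenvalue_of_pos_eigenvector (N := fusionMatrix k X)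
      (fun i j => Nat.cast_nonneg _) hv hr).csSup_eq]

omit [Fintype (SimpleClass C)] in
theorem fpdim_tensor (X Y : C) : fpdim k (X ⊗ Y) = fpdim k X * fpdim k Y := by
  have := IsFusionCategory.finite_simpleClass k (C := C)
  have := Fintype.ofFinite (SimpleClass C)
  obtain ⟨v, hv, h⟩ := exists_fusionMatrix_mulVec_eq k (C := C)
  have hmul : fusionMatrix k (X ⊗ Y) = fusionMatrix k X * fusionMatrix k Y := by
    ext Z W
    simp only [mul_apply, fusionMatrix_apply]
    rw [mult_congr k Z (α_ X Y W.rep), mult_tensor_left]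
    push_cast
    rfl
  have h1 := h (X ⊗ Y)
  rw [hmul, ← mulVec_mulVec, h, mulVec_smul, h] at h1
  have h2 := congrFun h1 (unitClass k)
  simp only [Pi.smul_apply, smul_eq_mul] at h2
  refine mul_right_cancel₀ (hv (unitClass k)).ne' ?_
  linarith

theorem fpdim_eq_sum (X : C) :
    fpdim k X = ∑ V : SimpleClass C, (mult k V X : ℝ) * fpdim k V.rep := by
  obtain ⟨v, hv, h⟩ := exists_fusionMatrix_mulVec_eq k (C := C)
  have hsum : fusionMatrix k X =
      ∑ V : SimpleClass C, (mult k V X : ℝ) • fusionMatrix k V.rep := by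
    ext Z W
    simp only [Matrix.sum_apply, Matrix.smul_apply, fusionMatrix_apply, smul_eq_mul]
    rw [mult_tensor_right]
    push_cast
    exact Finset.sum_congr rfl fun _ _ => mul_comm _ _
  have h1 := h X
  rw [hsum, sum_mulVec] at h1
  simp_rw [smul_mulVec, h] at h1
  have h2 := congrFun h1 (unitClass k)
  simp only [Finset.sum_apply, Pi.smul_apply, smul_eq_mul] at h2
  refine mul_right_cancel₀ (hv (unitClass k)).ne' ?_
  rw [← h2, Finset.sum_mul]
  exact Finset.sum_congr rfl fun _ _ => by ring

omit [Fintype (SimpleClass C)] in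
theorem fpdim_leftDual (X : C) : fpdim k (ᘁX) = fpdim k X := by
  have := IsFusionCategory.finite_simpleClass k (C := C)
  have := Fintype.ofFinite (SimpleClass C)
  obtain ⟨v, hv, h⟩ := exists_fusionMatrix_mulVec_eq k (C := C)
  have hvv : 0 < v ⬝ᵥ v := Finset.sum_pos (fun i _ => mul_pos (hv i) (hv i)) ⟨unitClass k,
    Finset.mem_univ _⟩
  refine mul_right_cancel₀ hvv.ne' ?_
  rw [← smul_eq_mul, ← smul_eq_mul, ← dotProduct_smul, ← dotProduct_smul, ← h, ← h,
    fusionMatrix_leftDual, dotProduct_mulVec, vecMul_transpose, dotProduct_comm]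

omit [Fintype (SimpleClass C)] in
theorem fpdim_nonneg (X : C) : 0 ≤ fpdim k X :=
  Real.sSup_nonneg fun _ h => h.1

omit [Fintype (SimpleClass C)] in
theorem fpdim_rep_pos (V : SimpleClass C) : 0 < fpdim k V.rep := by
  have := IsFusionCategory.finite_simpleClass k (C := C)
  have := Fintype.ofFinite (SimpleClass C)
  obtain ⟨v, hv, h⟩ := exists_fusionMatrix_mulVec_eq k (C := C)
  have h1 : 0 < (fusionMatrix k V.rep *ᵥ v) V := by
    refine Finset.sum_pos' (fun W _ => mul_nonneg (Nat.cast_nonneg _) (hv W).le)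
      ⟨unitClass k, Finset.mem_univ _, mul_pos (Nat.cast_pos.mpr ?_) (hv _)⟩
    obtain ⟨e⟩ := nonempty_unit_iso k (C := C)
    change 0 < mult k V (V.rep ⊗ (unitClass k).rep)
    rw [← mult_congr k V (whiskerLeftIso V.rep e), mult_congr k V (ρ_ V.rep), mult_self]
    exact Nat.one_pos
  rw [h] at h1
  exact pos_of_mul_pos_left h1 (hv V).le

end FrobeniusPerron

section Integral

variable {k : Type w} [Field k] {C : Type u} [Category.{v} C] [Abelian C]
    [Linear k C] [MonoidalCategory C] [MonoidalPreadditive C] [MonoidalLinear k C]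
    [RigidCategory C] [IsFusionCategory k C] [IsAlgClosed k] (hC : IsIntegralCategory k C)

include hC

theorem cast_dim (X : C) : (dim k X : ℝ) = fpdim k X := by
  obtain ⟨n, hn⟩ := hC X
  have h0 := fpdim_nonneg k X
  rw [dim]
  rw [hn] at h0 ⊢
  lift n to ℕ using by exact_mod_cast h0
  simp

theorem dim_tensor (X Y : C) : dim k (X ⊗ Y) = dim k X * dim k Y := by
  have := fpdim_tensor k X Y
  simp only [← cast_dim hC] at this
  exact_mod_cast this

theorem dim_eq_sum [Fintype (SimpleClass C)] (X : C) :
    dim k X = ∑ V : SimpleClass C, mult k V X * dim k V.rep := by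
  have := fpdim_eq_sum k X
  simp only [← cast_dim hC] at this
  exact_mod_cast this

theorem dim_leftDual (X : C) : dim k (ᘁX) = dim k X := by
  rw [dim, dim, fpdim_leftDual]

theorem dim_rep_pos (V : SimpleClass C) : 0 < dim k V.rep := by
  have := fpdim_rep_pos k V
  rw [← cast_dim hC] at this
  exact_mod_cast this

end Integral

/-! ### Homogeneous regular objects -/

section Regular

variable {k : Type w} [Field k] [IsAlgClosed k] {C : Type u} [Category.{v} C] [Abelian C]
    [Linear k C] [MonoidalCategory C] [MonoidalPreadditive C] [MonoidalLinear k C]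
    [RigidCategory C] [IsFusionCategory k C] {G : Type x} [Group G] (γ : Grading C G)

lemma mult_copies (Z : SimpleClass C) (n : ℕ) (X : C) :
    mult k Z (copies n X) = n * mult k Z X := by
  rw [mult, finrank_hom_biproduct]
  simp

lemma dim_copies (hC : IsIntegralCategory k C) (n : ℕ) (X : C) :
    dim k (copies n X) = n * dim k X := by
  have := IsFusionCategory.finite_simpleClass k (C := C)
  have := Fintype.ofFinite (SimpleClass C)
  rw [dim_eq_sum hC, dim_eq_sum hC X, Finset.mul_sum]
  simp_rw [mult_copies, mul_assoc]

open scoped Classical in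
lemma mult_regularObj (Z : SimpleClass C) (g : G) :
    mult k Z (regularObj k γ g) = if γ.deg Z = g then dim k Z.rep else 0 := by
  have := IsFusionCategory.finite_simpleClass k (C := C)
  have := Fintype.ofFinite (SimpleClass C)
  rw [mult, regularObj, finrank_hom_biproduct]
  change ∑ X : {X : SimpleClass C // γ.deg X = g},
    mult k Z (copies (dim k X.1.rep) X.1.rep) = _
  simp_rw [mult_copies, mult_rep]
  split_ifs with h
  · rw [Finset.sum_eq_single ⟨Z, h⟩]
    · simp
    · intro X _ hX
      rw [if_neg fun h => hX (Subtype.ext h), mul_zero]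
    · simp
  · refine Finset.sum_eq_zero fun X _ => ?_
    rw [if_neg, mul_zero]
    rintro rfl
    exact h X.2

lemma deg_mul_of_mult_ne_zero {X Y Z : SimpleClass C} (h : mult k Z (X.rep ⊗ Y.rep) ≠ 0) :
    γ.deg X * γ.deg Y = γ.deg Z := by
  have := Module.finrank_pos_iff.mp (Nat.pos_of_ne_zero h)
  obtain ⟨i, hi⟩ := exists_ne (0 : Z.rep ⟶ X.rep ⊗ Y.rep)
  exact γ.deg_mul X Y Z i (mono_of_nonzero_from_simple hi)

/-- `R_f ⊗ Y` contains each simple object `d(Y)` times as often as `R_{fg}` does, for `Y` simple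
of degree `g`: by duality, this is the dimension formula for `Z ⊗ ᘁY`. -/
lemma mult_regularObj_tensor_rep (hC : IsIntegralCategory k C) (f : G) (Z Y : SimpleClass C) :
    mult k Z (regularObj k γ f ⊗ Y.rep) =
      dim k Y.rep * mult k Z (regularObj k γ (f * γ.deg Y)) := by
  classical
  have := IsFusionCategory.finite_simpleClass k (C := C)
  have := Fintype.ofFinite (SimpleClass C)
  rw [mult_tensor_right]
  simp_rw [mult_regularObj]
  split_ifs with h
  · rw [mul_comm (dim k Y.rep), ← dim_leftDual (k := k) hC Y.rep, ← dim_tensor hC, dim_eq_sum hC]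
    refine Finset.sum_congr rfl fun X _ => ?_
    have hd : mult k X (Z.rep ⊗ ᘁY.rep) = mult k Z (X.rep ⊗ Y.rep) := by
      rw [← finrank_hom_rep_comm, finrank_tensorRight_hom k Z.rep (ᘁY.rep) Y.rep]
    rw [hd]
    by_cases hm : mult k Z (X.rep ⊗ Y.rep) = 0
    · rw [hm, zero_mul, zero_mul]
    · have := deg_mul_of_mult_ne_zero γ hm
      rw [h] at this
      rw [if_pos (mul_right_cancel this)]
  · rw [mul_zero]
    refine Finset.sum_eq_zero fun X _ => ?_
    by_cases hm : mult k Z (X.rep ⊗ Y.rep) = 0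
    · rw [hm, zero_mul]
    · rw [if_neg, mul_zero]
      rintro rfl
      exact h (deg_mul_of_mult_ne_zero γ hm).symm

lemma dim_regularObj_one (hC : IsIntegralCategory k C) :
    dim k (regularObj k γ 1) = trivialDim k γ := by
  classical
  have := IsFusionCategory.finite_simpleClass k (C := C)
  have := Fintype.ofFinite (SimpleClass C)
  rw [dim_eq_sum hC, trivialDim, finsum_eq_sum_of_fintype,
    ← Finset.sum_subtype (Finset.univ.filter fun X => γ.deg X = 1) (by simp)
      (fun X => dim k X.rep ^ 2), Finset.sum_filter]
  refine Finset.sum_congr rfl fun X _ => ?_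
  rw [mult_regularObj]
  split_ifs <;> ring

/-- All components of a faithful grading have the same Frobenius-Perron dimension. -/
theorem dim_regularObj (hC : IsIntegralCategory k C) (hγ : γ.Faithful) (g : G) :
    dim k (regularObj k γ g) = trivialDim k γ := by
  have := IsFusionCategory.finite_simpleClass k (C := C)
  have := Fintype.ofFinite (SimpleClass C)
  obtain ⟨Y, rfl⟩ := hγ g
  rw [← dim_regularObj_one γ hC]
  refine Nat.eq_of_mul_eq_mul_left (dim_rep_pos hC Y) ?_
  have h := dim_tensor hC (regularObj k γ 1) Y.rep
  rw [mul_comm _ (dim k Y.rep)] at h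
  rw [← h, dim_eq_sum hC (regularObj k γ _), dim_eq_sum hC (_ ⊗ _), Finset.mul_sum]
  refine Finset.sum_congr rfl fun Z _ => ?_
  rw [mult_regularObj_tensor_rep γ hC, one_mul, mul_assoc]

theorem nonempty_regularObj_tensor_iso (hC : IsIntegralCategory k C) (hγ : γ.Faithful) (f g : G) :
    Nonempty (regularObj k γ f ⊗ regularObj k γ g ≅
      copies (trivialDim k γ) (regularObj k γ (f * g))) := by
  classical
  have := IsFusionCategory.finite_simpleClass k (C := C)
  have := Fintype.ofFinite (SimpleClass C)
  refine nonempty_iso_of_mult_eq k fun Z => ?_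
  rw [mult_copies, mult_tensor_left, ← dim_regularObj γ hC hγ g, dim_eq_sum hC, Finset.sum_mul]
  refine Finset.sum_congr rfl fun Y _ => ?_
  rw [mult_regularObj_tensor_rep γ hC, mult_regularObj γ Y]
  split_ifs with h
  · rw [h]; ring
  · simp

end Regular

/-! ### Determinants of automorphisms -/

section AutDet

variable {k : Type w} [Field k] {C : Type u} [Category.{v} C] [Abelian C]
    [Linear k C] [MonoidalCategory C] [MonoidalPreadditive C] [MonoidalLinear k C]
    [RigidCategory C] [IsFusionCategory k C]

lemma autDet_eq_prod [Fintype (SimpleClass C)] {X : C} (φ : X ≅ X) :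
    autDet k φ = ∏ Z : SimpleClass C,
      LinearEquiv.det (Linear.homCongr k (Iso.refl Z.rep) φ) ^ dim k Z.rep :=
  finprod_eq_prod_of_fintype _

lemma homCongr_trans {A X Y Z : C} (φ : X ≅ Y) (ψ : Y ≅ Z) :
    Linear.homCongr k (Iso.refl A) (φ ≪≫ ψ) =
      (Linear.homCongr k (Iso.refl A) φ).trans (Linear.homCongr k (Iso.refl A) ψ) := by
  ext f
  simp [Linear.homCongr_apply]

lemma autDet_trans {X : C} (φ ψ : X ≅ X) : autDet k (φ ≪≫ ψ) = autDet k φ * autDet k ψ := by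
  have := IsFusionCategory.finite_simpleClass k (C := C)
  have := Fintype.ofFinite (SimpleClass C)
  simp only [autDet_eq_prod, ← Finset.prod_mul_distrib, ← mul_pow]
  refine Finset.prod_congr rfl fun Z _ => ?_
  rw [homCongr_trans, mul_comm, ← map_mul]
  rfl

lemma autDet_refl (X : C) : autDet k (Iso.refl X) = 1 := by
  have := autDet_trans (k := k) (Iso.refl X) (Iso.refl X)
  rwa [Iso.refl_trans, left_eq_mul] at this

lemma autDet_conj {X Y : C} (e : X ≅ Y) (φ : X ≅ X) :
    autDet k (e.symm ≪≫ φ ≪≫ e) = autDet k φ := by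
  have := IsFusionCategory.finite_simpleClass k (C := C)
  have := Fintype.ofFinite (SimpleClass C)
  simp only [autDet_eq_prod]
  refine Finset.prod_congr rfl fun Z _ => congrArg (· ^ _) ?_
  rw [← LinearEquiv.det_conj _ (Linear.homCongr k (Iso.refl Z.rep) e), homCongr_trans,
    homCongr_trans]
  congr 1
  ext f
  simp [Linear.homCongr_apply, Linear.homCongr_symm_apply]

/-- A functor that multiplies Frobenius-Perron dimensions by `n` raises determinants to the power
`n`. -/
theorem autDet_mapIso [IsAlgClosed k] {E : Type u'} [Category.{v'} E] [Abelian E]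
    [Linear k E] [MonoidalCategory E] [MonoidalPreadditive E] [MonoidalLinear k E]
    [RigidCategory E] [IsFusionCategory k E] (hE : IsIntegralCategory k E)
    (F : C ⥤ E) [F.Additive] [F.Linear k] (n : ℕ)
    (hF : ∀ V : SimpleClass C, dim k (F.obj V.rep) = n * dim k V.rep) {X : C} (φ : X ≅ X) :
    autDet k (F.mapIso φ) = autDet k φ ^ n := by
  have := IsFusionCategory.finite_simpleClass k (C := C)
  have := Fintype.ofFinite (SimpleClass C)
  have := IsFusionCategory.finite_simpleClass k (C := E)
  have := Fintype.ofFinite (SimpleClass E)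
  simp only [autDet_eq_prod, det_homCongr_mapIso k F, ← Finset.prod_pow]
  rw [Finset.prod_comm]
  refine Finset.prod_congr rfl fun V _ => ?_
  simp_rw [← pow_mul]
  rw [Finset.prod_pow_eq_pow_sum, mul_comm, ← hF, dim_eq_sum hE]

variable [IsAlgClosed k]

lemma autDet_whiskerRight (hC : IsIntegralCategory k C) {X : C} (φ : X ≅ X) (W : C) :
    autDet k (whiskerRightIso φ W) = autDet k φ ^ dim k W :=
  autDet_mapIso hC (tensorRight W) _ (fun _ =>
    (dim_tensor hC _ _).trans (mul_comm _ _)) φ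

lemma autDet_whiskerLeft (hC : IsIntegralCategory k C) (W : C) {X : C} (φ : X ≅ X) :
    autDet k (whiskerLeftIso W φ) = autDet k φ ^ dim k W :=
  autDet_mapIso hC (tensorLeft W) _ (fun _ => dim_tensor hC _ _) φ

variable (C) in
/-- The functor `X ↦ n X`. -/
def copiesFunctor (n : ℕ) : C ⥤ C where
  obj X := copies n X
  map f := biproduct.map fun _ => f

lemma copies_map_add (n : ℕ) {X Y : C} (f g : X ⟶ Y) :
    (biproduct.map fun _ : Fin n => f + g) =
      (biproduct.map fun _ => f) + biproduct.map fun _ => g := by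
  apply biproduct.hom_ext
  simp

lemma copies_map_smul (n : ℕ) {X Y : C} (r : k) (f : X ⟶ Y) :
    (biproduct.map fun _ : Fin n => r • f) = r • biproduct.map fun _ => f := by
  apply biproduct.hom_ext
  simp

instance (n : ℕ) : (copiesFunctor C n).Additive where
  map_add {_ _ f g} := copies_map_add n f g

instance (n : ℕ) : (copiesFunctor C n).Linear k where
  map_smul f r := copies_map_smul n r f

/-- The direct sum of `n` copies of an isomorphism. -/
abbrev copiesIso (n : ℕ) {X Y : C} (φ : X ≅ Y) : copies n X ≅ copies n Y :=
  biproduct.mapIso fun _ => φ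

lemma autDet_copiesIso (hC : IsIntegralCategory k C) (n : ℕ) {X : C} (φ : X ≅ X) :
    autDet k (copiesIso n φ) = autDet k φ ^ n := by
  rw [← autDet_mapIso hC (copiesFunctor C n) n (fun V => dim_copies hC n V.rep) φ]
  rfl

end AutDet

/-! ### Determinants relative to identifications -/

section RelDet

variable {k : Type w} [Field k] {C : Type u} [Category.{v} C] [Abelian C]
    [Linear k C] [MonoidalCategory C] [MonoidalPreadditive C] [MonoidalLinear k C]
    [RigidCategory C] [IsFusionCategory k C]

variable (k) in
/-- The determinant of an isomorphism `φ : X ≅ Y` whose source and target are both identified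
with `M`. -/
def relDet {X Y M : C} (a : X ≅ M) (b : Y ≅ M) (φ : X ≅ Y) : kˣ :=
  autDet k (a.symm ≪≫ φ ≪≫ b)

lemma relDet_trans {X Y Z M : C} (a : X ≅ M) (b : Y ≅ M) (c : Z ≅ M) (φ : X ≅ Y) (ψ : Y ≅ Z) :
    relDet k a c (φ ≪≫ ψ) = relDet k a b φ * relDet k b c ψ := by
  rw [relDet, relDet, relDet, ← autDet_trans]
  congr 1
  ext
  simp

lemma relDet_trans_iso {X Y M N : C} (a : X ≅ M) (b : Y ≅ M) (e : M ≅ N) (φ : X ≅ Y) :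
    relDet k (a ≪≫ e) (b ≪≫ e) φ = relDet k a b φ := by
  rw [relDet, relDet, ← autDet_conj e]
  congr 1
  ext
  simp

variable [IsAlgClosed k]

lemma relDet_whiskerRight (hC : IsIntegralCategory k C) {X Y M : C} (a : X ≅ M) (b : Y ≅ M)
    (φ : X ≅ Y) (W : C) :
    relDet k (whiskerRightIso a W) (whiskerRightIso b W) (whiskerRightIso φ W) =
      relDet k a b φ ^ dim k W := by
  rw [relDet, relDet, ← autDet_whiskerRight hC]
  congr 1
  ext
  simp

lemma relDet_whiskerLeft (hC : IsIntegralCategory k C) {X Y M : C} (a : X ≅ M) (b : Y ≅ M)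
    (φ : X ≅ Y) (W : C) :
    relDet k (whiskerLeftIso W a) (whiskerLeftIso W b) (whiskerLeftIso W φ) =
      relDet k a b φ ^ dim k W := by
  rw [relDet, relDet, ← autDet_whiskerLeft hC]
  congr 1
  ext
  simp

/-- If `r` and `r'` identify `φ` with the direct sum of `n` copies of `ψ`, then the determinant
of `φ` is the `n`-th power of that of `ψ`. -/
lemma relDet_copies (hC : IsIntegralCategory k C) {n : ℕ} {X X' P P' M : C} (r : X ≅ copies n P)
    (r' : X' ≅ copies n P') (φ : X ≅ X') (ψ : P ≅ P')
    (h : ∀ j, φ.hom ≫ r'.hom ≫ biproduct.π _ j = r.hom ≫ biproduct.π _ j ≫ ψ.hom)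
    (a : P ≅ M) (b : P' ≅ M) :
    relDet k (r ≪≫ copiesIso n a) (r' ≪≫ copiesIso n b) φ = relDet k a b ψ ^ n := by
  rw [relDet, relDet, ← autDet_copiesIso hC]
  congr 1
  ext j
  have hj : φ.hom ≫ r'.hom ≫ biproduct.π _ j ≫ b.hom =
      r.hom ≫ biproduct.π _ j ≫ ψ.hom ≫ b.hom := by
    have := h j =≫ b.hom
    simpa only [Category.assoc] using this
  simp only [Iso.trans_hom, Iso.symm_hom, Iso.trans_inv, biproduct.mapIso_hom,
    biproduct.mapIso_inv, Category.assoc, biproduct.map_π, hj]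
  simp

end RelDet

/-! ### Components of identifications with multiple copies -/

section Components

variable {C : Type u} [Category.{v} C] [Abelian C]

@[simp]
lemma copiesSwap_hom_π_assoc (m n : ℕ) (X : C) (i : Fin n) {Y : C} (f : copies m X ⟶ Y) :
    (copiesSwap m n X).hom ≫ biproduct.π (fun _ : Fin n => copies m X) i ≫ f =
      (biproduct.map fun _ : Fin m => biproduct.π (fun _ : Fin n => X) i) ≫ f := by
  simp [copiesSwap]

lemma copies_hom_ext₂ {m n : ℕ} {A X : C} {φ ψ : A ⟶ copies m (copies n X)}
    (h : ∀ (i : Fin m) (j : Fin n), φ ≫ biproduct.π _ i ≫ biproduct.π _ j =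
      ψ ≫ biproduct.π _ i ≫ biproduct.π _ j) : φ = ψ := by
  refine biproduct.hom_ext _ _ fun i => biproduct.hom_ext _ _ fun j => ?_
  simpa only [Category.assoc] using h i j

lemma copies_hom_ext₃ {l m n : ℕ} {A X : C} {φ ψ : A ⟶ copies l (copies m (copies n X))}
    (h : ∀ (a : Fin l) (i : Fin m) (j : Fin n),
      φ ≫ biproduct.π _ a ≫ biproduct.π _ i ≫ biproduct.π _ j =
      ψ ≫ biproduct.π _ a ≫ biproduct.π _ i ≫ biproduct.π _ j) : φ = ψ := by
  refine biproduct.hom_ext _ _ fun a => copies_hom_ext₂ fun i j => ?_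
  simpa only [Category.assoc] using h a i j

variable {I : Type*} (R : I → C)

lemma eqToHom_π_π {y z : I} (h : y = z) {m n : ℕ}
    (p : copies m (copies n (R y)) = copies m (copies n (R z))) (i : Fin m) (j : Fin n) :
    eqToHom p ≫ biproduct.π _ i ≫ biproduct.π _ j =
      biproduct.π _ i ≫ biproduct.π _ j ≫ eqToHom (congrArg R h) := by
  subst h
  simp

lemma eqToHom_π_π_π {y z : I} (h : y = z) {l m n : ℕ}
    (p : copies l (copies m (copies n (R y))) = copies l (copies m (copies n (R z))))
    (a : Fin l) (i : Fin m) (j : Fin n) :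
    eqToHom p ≫ biproduct.π _ a ≫ biproduct.π _ i ≫ biproduct.π _ j =
      biproduct.π _ a ≫ biproduct.π _ i ≫ biproduct.π _ j ≫ eqToHom (congrArg R h) := by
  subst h
  simp

end Components

section Cocycle

variable {k : Type w} [Field k] {C : Type u} [Category.{v} C] [Abelian C]
    [Linear k C] [MonoidalCategory C] [MonoidalPreadditive C] [MonoidalLinear k C]
    [RigidCategory C] [IsFusionCategory k C] {G : Type x} [Group G] {γ : Grading C G}

namespace Identification

variable (t : Identification k γ)

/-- The component `R_f ⊗ R_g ⟶ R_{fg}` of index `i` of the identification `t f g`. -/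
def comp (f g : G) (i : Fin (trivialDim k γ)) :
    regularObj k γ f ⊗ regularObj k γ g ⟶ regularObj k γ (f * g) :=
  (t f g).hom ≫ biproduct.π _ i

lemma hom_π (f g : G) (i : Fin (trivialDim k γ)) :
    (t f g).hom ≫ biproduct.π _ i = t.comp f g i := rfl

lemma eqToHom_whiskerRight_comp {f f' : G} (h : f = f') (g : G) (i : Fin (trivialDim k γ))
    (p : regularObj k γ f = regularObj k γ f') :
    eqToHom p ▷ regularObj k γ g ≫ t.comp f' g i = t.comp f g i ≫ eqToHom (by rw [h]) := by
  subst h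
  simp

lemma whiskerLeft_eqToHom_comp (f : G) {g g' : G} (h : g = g') (i : Fin (trivialDim k γ))
    (p : regularObj k γ g = regularObj k γ g') :
    regularObj k γ f ◁ eqToHom p ≫ t.comp f g' i = t.comp f g i ≫ eqToHom (by rw [h]) := by
  subst h
  simp

lemma left_hom_π_π (f g h : G) (i j : Fin (trivialDim k γ)) :
    (t.left f g h).hom ≫ biproduct.π _ i ≫ biproduct.π _ j =
      t.comp f g i ▷ regularObj k γ h ≫ t.comp (f * g) h j := by
  simp [left, comp]

lemma right_hom_π_π (f g h : G) (i j : Fin (trivialDim k γ)) :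
    (t.right f g h).hom ≫ biproduct.π _ i ≫ biproduct.π _ j =
      regularObj k γ f ◁ t.comp g h j ≫ t.comp f (g * h) i ≫ eqToHom (by rw [mul_assoc]) := by
  simp only [right, comp, Iso.trans_hom, eqToIso.hom, Category.assoc]
  rw [eqToHom_π_π (regularObj k γ) (mul_assoc f g h).symm]
  simp

/-- Tensoring with `R_g` on the right and applying `t x g` in each summand. -/
def distribRight (x g : G) :
    copies (trivialDim k γ) (copies (trivialDim k γ) (regularObj k γ x)) ⊗ regularObj k γ g ≅
      copies (trivialDim k γ) (copies (trivialDim k γ) (copies (trivialDim k γ)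
        (regularObj k γ (x * g)))) :=
  rightDistributor (fun _ => copies (trivialDim k γ) (regularObj k γ x)) (regularObj k γ g) ≪≫
    copiesIso _ (rightDistributor (fun _ => regularObj k γ x) (regularObj k γ g) ≪≫
      copiesIso _ (t x g))

/-- Tensoring with `R_f` on the left and applying `t f x` in each summand; the new index is
moved to the first place. -/
def distribLeft (f x : G) :
    regularObj k γ f ⊗ copies (trivialDim k γ) (copies (trivialDim k γ) (regularObj k γ x)) ≅
      copies (trivialDim k γ) (copies (trivialDim k γ) (copies (trivialDim k γ)
        (regularObj k γ (f * x)))) :=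
  leftDistributor (regularObj k γ f) (fun _ => copies (trivialDim k γ) (regularObj k γ x)) ≪≫
    copiesIso _ (leftDistributor (regularObj k γ f) (fun _ => regularObj k γ x) ≪≫
      copiesIso _ (t f x) ≪≫ copiesSwap _ _ _) ≪≫ copiesSwap _ _ _

lemma whiskerRight_distribRight (x g : G) {A : C}
    (φ : A ⟶ copies (trivialDim k γ) (copies (trivialDim k γ) (regularObj k γ x)))
    (a b c : Fin (trivialDim k γ)) :
    φ ▷ regularObj k γ g ≫ (t.distribRight x g).hom ≫
        biproduct.π _ a ≫ biproduct.π _ b ≫ biproduct.π _ c =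
      (φ ≫ biproduct.π _ a ≫ biproduct.π _ b) ▷ regularObj k γ g ≫ t.comp x g c := by
  simp [distribRight, comp]

lemma whiskerLeft_distribLeft (f x : G) {A : C}
    (φ : A ⟶ copies (trivialDim k γ) (copies (trivialDim k γ) (regularObj k γ x)))
    (a b c : Fin (trivialDim k γ)) :
    regularObj k γ f ◁ φ ≫ (t.distribLeft f x).hom ≫
        biproduct.π _ a ≫ biproduct.π _ b ≫ biproduct.π _ c =
      regularObj k γ f ◁ (φ ≫ biproduct.π _ b ≫ biproduct.π _ c) ≫ t.comp f x a := by
  simp [distribLeft, comp]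

end Identification
end Cocycle
/-! ### The cocycle identity -/

section Cocycle

section Whisker

variable {C : Type u} [Category.{v} C] [Abelian C] [MonoidalCategory C] [MonoidalPreadditive C]

/-- A decomposition of `X` into copies of `P` gives one of `X ⊗ W` into copies of `P ⊗ W`. -/
def whiskerRightCopies {n : ℕ} {X P : C} (r : X ≅ copies n P) (W : C) :
    X ⊗ W ≅ copies n (P ⊗ W) :=
  whiskerRightIso r W ≪≫ rightDistributor (fun _ => P) W

/-- A decomposition of `X` into copies of `P` gives one of `W ⊗ X` into copies of `W ⊗ P`. -/
def whiskerLeftCopies {n : ℕ} {X P : C} (W : C) (r : X ≅ copies n P) :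
    W ⊗ X ≅ copies n (W ⊗ P) :=
  whiskerLeftIso W r ≪≫ leftDistributor W (fun _ => P)

@[simp]
lemma whiskerRightCopies_hom_π {n : ℕ} {X P : C} (r : X ≅ copies n P) (W : C) (j : Fin n) :
    (whiskerRightCopies r W).hom ≫ biproduct.π (fun _ : Fin n => P ⊗ W) j =
      (r.hom ≫ biproduct.π _ j) ▷ W := by
  simp [whiskerRightCopies]

@[simp]
lemma whiskerLeftCopies_hom_π {n : ℕ} {X P : C} (W : C) (r : X ≅ copies n P) (j : Fin n) :
    (whiskerLeftCopies W r).hom ≫ biproduct.π (fun _ : Fin n => W ⊗ P) j =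
      W ◁ (r.hom ≫ biproduct.π _ j) := by
  simp [whiskerLeftCopies]

@[simp]
lemma whiskerRightCopies_hom_π_assoc {n : ℕ} {X P : C} (r : X ≅ copies n P) (W : C) (j : Fin n)
    {Y : C} (f : P ⊗ W ⟶ Y) :
    (whiskerRightCopies r W).hom ≫ biproduct.π (fun _ : Fin n => P ⊗ W) j ≫ f =
      (r.hom ≫ biproduct.π _ j) ▷ W ≫ f := by
  simp [whiskerRightCopies]

@[simp]
lemma whiskerLeftCopies_hom_π_assoc {n : ℕ} {X P : C} (W : C) (r : X ≅ copies n P) (j : Fin n)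
    {Y : C} (f : W ⊗ P ⟶ Y) :
    (whiskerLeftCopies W r).hom ≫ biproduct.π (fun _ : Fin n => W ⊗ P) j ≫ f =
      W ◁ (r.hom ≫ biproduct.π _ j) ≫ f := by
  simp [whiskerLeftCopies]

lemma copiesIso_hom_π_assoc {n : ℕ} {A P M N : C} (r : A ⟶ copies n P) (a : P ≅ M) (j : Fin n)
    (f : M ⟶ N) :
    r ≫ (copiesIso n a).hom ≫ biproduct.π (fun _ : Fin n => M) j ≫ f =
      (r ≫ biproduct.π _ j) ≫ a.hom ≫ f := by
  simp

end Whisker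

variable {k : Type w} [Field k] {C : Type u} [Category.{v} C] [Abelian C]
    [Linear k C] [MonoidalCategory C] [MonoidalPreadditive C] [MonoidalLinear k C]
    [RigidCategory C] [IsFusionCategory k C] {G : Type x} [Group G] {γ : Grading C G}

namespace Identification

variable (t : Identification k γ) (f g h i : G)

/-- This and the following four lemmas compare, for each parenthesization of `R_f, R_g, R_h, R_i`,
the two descriptions of its identification with `D³ R_{fghi}` that belong to the two arrows of the
pentagon at that vertex. All of them are checked on components, where the component of index
`(a, b, c)` uses `a`, `b` and `c` for the first, second and third tensor sign. -/
lemma whiskerRight_left_eq :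
    whiskerRightIso (t.left f g h) (regularObj k γ i) ≪≫ t.distribRight (f * g * h) i =
      whiskerRightCopies (whiskerRightCopies (t f g) (regularObj k γ h)) (regularObj k γ i) ≪≫
        copiesIso _ (t.left (f * g) h i) := by
  ext1
  refine copies_hom_ext₃ fun a b c => ?_
  simp only [Iso.trans_hom, Category.assoc, whiskerRightIso_hom]
  rw [copiesIso_hom_π_assoc, left_hom_π_π, whiskerRight_distribRight, left_hom_π_π]
  simp [comp]

lemma whiskerRight_right_eq (p : copies (trivialDim k γ) (copies (trivialDim k γ)
      (copies (trivialDim k γ) (regularObj k γ (f * (g * h) * i)))) =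
      copies (trivialDim k γ) (copies (trivialDim k γ)
      (copies (trivialDim k γ) (regularObj k γ (f * g * h * i))))) :
    whiskerRightIso (t.right f g h) (regularObj k γ i) ≪≫ t.distribRight (f * g * h) i =
      (whiskerRightCopies (whiskerLeftCopies (regularObj k γ f) (t g h)) (regularObj k γ i) ≪≫
        copiesIso _ (t.left f (g * h) i)) ≪≫ copiesSwap _ _ _ ≪≫ eqToIso p := by
  ext1
  refine copies_hom_ext₃ fun a b c => ?_
  simp only [Iso.trans_hom, Category.assoc, eqToIso.hom, whiskerRightIso_hom]
  rw [whiskerRight_distribRight, right_hom_π_π,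
    eqToHom_π_π_π (regularObj k γ) (by rw [mul_assoc f g h]),
    copiesSwap_hom_π_assoc, biproduct.map_π_assoc, copiesIso_hom_π_assoc]
  simp only [comp_whiskerRight, Category.assoc]
  rw [eqToHom_whiskerRight_comp t (by rw [mul_assoc f g h]),
    reassoc_of% (t.left_hom_π_π f (g * h) i)]
  simp [comp]

lemma whiskerLeft_left_eq (p : copies (trivialDim k γ) (copies (trivialDim k γ)
      (copies (trivialDim k γ) (regularObj k γ (f * (g * h * i))))) =
      copies (trivialDim k γ) (copies (trivialDim k γ)
      (copies (trivialDim k γ) (regularObj k γ (f * g * h * i)))))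
    (q : copies (trivialDim k γ) (copies (trivialDim k γ)
      (copies (trivialDim k γ) (regularObj k γ (f * (g * h) * i)))) =
      copies (trivialDim k γ) (copies (trivialDim k γ)
      (copies (trivialDim k γ) (regularObj k γ (f * g * h * i))))) :
    whiskerLeftIso (regularObj k γ f) (t.left g h i) ≪≫ t.distribLeft f (g * h * i) ≪≫
        eqToIso p =
      (whiskerLeftCopies (regularObj k γ f) (whiskerRightCopies (t g h) (regularObj k γ i)) ≪≫
        copiesIso _ (t.right f (g * h) i)) ≪≫ copiesSwap _ _ _ ≪≫ eqToIso q := by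
  ext1
  refine copies_hom_ext₃ fun a b c => ?_
  simp only [Iso.trans_hom, Category.assoc, eqToIso.hom, whiskerLeftIso_hom]
  rw [eqToHom_π_π_π (regularObj k γ) (by simp only [mul_assoc]),
    eqToHom_π_π_π (regularObj k γ) (by rw [mul_assoc f g h]),
    copiesSwap_hom_π_assoc, biproduct.map_π_assoc, copiesIso_hom_π_assoc,
    reassoc_of% (t.whiskerLeft_distribLeft f), left_hom_π_π,
    reassoc_of% (t.right_hom_π_π f (g * h) i)]
  simp [comp]

lemma whiskerRightCopies_right_eq (q : copies (trivialDim k γ) (copies (trivialDim k γ)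
      (copies (trivialDim k γ) (regularObj k γ (f * g * (h * i))))) =
      copies (trivialDim k γ) (copies (trivialDim k γ)
      (copies (trivialDim k γ) (regularObj k γ (f * g * h * i))))) :
    whiskerRightCopies (t f g) (regularObj k γ h ⊗ regularObj k γ i) ≪≫
        copiesIso _ (t.right (f * g) h i) =
      (whiskerLeftCopies (regularObj k γ f ⊗ regularObj k γ g) (t h i) ≪≫
        copiesIso _ (t.left f g (h * i))) ≪≫ copiesSwap _ _ _ ≪≫ copiesIso _ (copiesSwap _ _ _) ≪≫
          eqToIso q := by
  ext1
  refine copies_hom_ext₃ fun a b c => ?_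
  simp only [Iso.trans_hom, Category.assoc, eqToIso.hom]
  rw [copiesIso_hom_π_assoc, right_hom_π_π,
    eqToHom_π_π_π (regularObj k γ) (by rw [mul_assoc (f * g) h i]), biproduct.mapIso_hom,
    biproduct.mapIso_hom,
    biproduct.map_π_assoc, copiesSwap_hom_π_assoc, copiesSwap_hom_π_assoc, biproduct.map_π_assoc,
    biproduct.map_π_assoc, biproduct.map_π_assoc,
    reassoc_of% (t.left_hom_π_π f g (h * i)), whiskerRightCopies_hom_π, hom_π,
    whiskerLeftCopies_hom_π_assoc, hom_π,
    whisker_exchange_assoc]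

lemma whiskerLeft_right_eq (p : copies (trivialDim k γ) (copies (trivialDim k γ)
      (copies (trivialDim k γ) (regularObj k γ (f * (g * h * i))))) =
      copies (trivialDim k γ) (copies (trivialDim k γ)
      (copies (trivialDim k γ) (regularObj k γ (f * g * h * i)))))
    (q : copies (trivialDim k γ) (copies (trivialDim k γ)
      (copies (trivialDim k γ) (regularObj k γ (f * g * (h * i))))) =
      copies (trivialDim k γ) (copies (trivialDim k γ)
      (copies (trivialDim k γ) (regularObj k γ (f * g * h * i))))) :
    whiskerLeftIso (regularObj k γ f) (t.right g h i) ≪≫ t.distribLeft f (g * h * i) ≪≫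
        eqToIso p =
      (whiskerLeftCopies (regularObj k γ f) (whiskerLeftCopies (regularObj k γ g) (t h i)) ≪≫
        copiesIso _ (t.right f g (h * i))) ≪≫ copiesSwap _ _ _ ≪≫ copiesIso _ (copiesSwap _ _ _) ≪≫
          eqToIso q := by
  ext1
  refine copies_hom_ext₃ fun a b c => ?_
  simp only [Iso.trans_hom, Category.assoc, eqToIso.hom, whiskerLeftIso_hom]
  rw [eqToHom_π_π_π (regularObj k γ) (by simp only [mul_assoc]),
    eqToHom_π_π_π (regularObj k γ) (by rw [mul_assoc (f * g) h i]), biproduct.mapIso_hom,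
    biproduct.mapIso_hom,
    biproduct.map_π_assoc, copiesSwap_hom_π_assoc, copiesSwap_hom_π_assoc, biproduct.map_π_assoc,
    biproduct.map_π_assoc, biproduct.map_π_assoc,
    reassoc_of% (t.whiskerLeft_distribLeft f), right_hom_π_π,
    reassoc_of% (t.right_hom_π_π f g (h * i)),
    whiskerLeftCopies_hom_π_assoc, whiskerLeftCopies_hom_π, hom_π]
  simp only [MonoidalCategory.whiskerLeft_comp, Category.assoc]
  rw [reassoc_of% (t.whiskerLeft_eqToHom_comp f (mul_assoc g h i).symm)]
  simp

variable [IsAlgClosed k]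

/-- The pentagon of the associators of `R_f, R_g, R_h, R_i`. Each index of a multiple copy belongs
to one of the three tensor product signs, so each of the five parenthesized products is identified
with `D³ R_{fghi}` consistently at both of its ends; hence no sign of a permutation appears. -/
theorem alpha_pentagon (hC : IsIntegralCategory k C) (hγ : γ.Faithful) :
    t.alpha f g h * t.alpha f (g * h) i * t.alpha g h i =
      t.alpha (f * g) h i * t.alpha f g (h * i) := by
  have p : copies (trivialDim k γ) (copies (trivialDim k γ)
      (copies (trivialDim k γ) (regularObj k γ (f * (g * h * i))))) =
      copies (trivialDim k γ) (copies (trivialDim k γ)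
      (copies (trivialDim k γ) (regularObj k γ (f * g * h * i)))) := by simp only [mul_assoc]
  have q₁ : copies (trivialDim k γ) (copies (trivialDim k γ)
      (copies (trivialDim k γ) (regularObj k γ (f * (g * h) * i)))) =
      copies (trivialDim k γ) (copies (trivialDim k γ)
      (copies (trivialDim k γ) (regularObj k γ (f * g * h * i)))) := by simp only [mul_assoc]
  have q₂ : copies (trivialDim k γ) (copies (trivialDim k γ)
      (copies (trivialDim k γ) (regularObj k γ (f * g * (h * i))))) =
      copies (trivialDim k γ) (copies (trivialDim k γ)
      (copies (trivialDim k γ) (regularObj k γ (f * g * h * i)))) := by simp only [mul_assoc]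
  -- `eₙ` computes the determinant of one arrow of the pentagon relative to these identifications.
  have e₁ := relDet_trans_iso (k := k)
    (whiskerRightIso (t.left f g h) (regularObj k γ i)) (whiskerRightIso (t.right f g h) _)
    (t.distribRight (f * g * h) i) (whiskerRightIso (α_ _ _ _) _)
  rw [relDet_whiskerRight hC, dim_regularObj γ hC hγ] at e₁
  have e₂ := relDet_trans_iso (k := k)
    (whiskerRightCopies (whiskerLeftCopies (regularObj k γ f) (t g h)) (regularObj k γ i) ≪≫
        copiesIso _ (t.left f (g * h) i))
    (whiskerLeftCopies (regularObj k γ f) (whiskerRightCopies (t g h) (regularObj k γ i)) ≪≫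
        copiesIso _ (t.right f (g * h) i))
    (copiesSwap _ _ _ ≪≫ eqToIso q₁) (α_ _ _ _)
  rw [relDet_copies hC _ _ _ (α_ _ _ _) (by simp), ← whiskerRight_right_eq,
    ← whiskerLeft_left_eq _ _ _ _ _ p] at e₂
  have e₃ := relDet_trans_iso (k := k)
    (whiskerLeftIso (regularObj k γ f) (t.left g h i)) (whiskerLeftIso _ (t.right g h i))
    (t.distribLeft f (g * h * i) ≪≫ eqToIso p) (whiskerLeftIso _ (α_ _ _ _))
  rw [relDet_whiskerLeft hC, dim_regularObj γ hC hγ] at e₃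
  have e₄ := relDet_copies (k := k) hC
    (whiskerRightCopies (whiskerRightCopies (t f g) (regularObj k γ h)) (regularObj k γ i))
    (whiskerRightCopies (t f g) (regularObj k γ h ⊗ regularObj k γ i)) (α_ _ _ _) (α_ _ _ _)
    (by simp) (t.left (f * g) h i) (t.right (f * g) h i)
  rw [← whiskerRight_left_eq] at e₄
  have e₅ := relDet_trans_iso (k := k)
    (whiskerLeftCopies (regularObj k γ f ⊗ regularObj k γ g) (t h i) ≪≫
        copiesIso _ (t.left f g (h * i)))
    (whiskerLeftCopies (regularObj k γ f) (whiskerLeftCopies (regularObj k γ g) (t h i)) ≪≫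
        copiesIso _ (t.right f g (h * i)))
    (copiesSwap _ _ _ ≪≫ copiesIso _ (copiesSwap _ _ _) ≪≫ eqToIso q₂) (α_ _ _ _)
  rw [relDet_copies hC _ _ _ (α_ _ _ _) (by simp), ← whiskerRightCopies_right_eq,
    ← whiskerLeft_right_eq _ _ _ _ _ p] at e₅
  change relDet k (t.left f g h) (t.right f g h) _ ^ _ *
    relDet k (t.left f (g * h) i) (t.right f (g * h) i) _ ^ _ *
    relDet k (t.left g h i) (t.right g h i) _ ^ _ =
    relDet k (t.left (f * g) h i) (t.right (f * g) h i) _ ^ _ *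
    relDet k (t.left f g (h * i)) (t.right f g (h * i)) _ ^ _
  rw [← e₁, ← e₂, ← e₃, ← e₄, ← e₅, ← relDet_trans, ← relDet_trans, ← relDet_trans]
  congr 1
  ext
  simp

theorem alpha_mem_Z3 (hC : IsIntegralCategory k C) (hγ : γ.Faithful) : t.alpha ∈ Z3 G kˣ := by
  rw [Z3, MonoidHom.mem_ker]
  funext f g h i
  have := t.alpha_pentagon f g h i hC hγ
  change t.alpha g h i * (t.alpha (f * g) h i)⁻¹ * t.alpha f (g * h) i *
    (t.alpha f g (h * i))⁻¹ * t.alpha f g h = 1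
  calc _ = (t.alpha f g h * t.alpha f (g * h) i * t.alpha g h i) *
        (t.alpha (f * g) h i * t.alpha f g (h * i))⁻¹ := by
        rw [mul_inv]
        ac_rfl
    _ = 1 := by rw [this, mul_inv_cancel]

end Identification
end Cocycle
end GradedFusion

/-! ### Independence of the identifications -/

lemma GroupH3.IsCocycleWithClass.mul_d₂ {G : Type x} [Group G] {M : Type w} [CommGroup M]
    {α β : G → G → G → M} {c : H3 G M} (h : IsCocycleWithClass α c) (hβ : β ∈ Z3 G M)
    (μ : G → G → M) (hμ : β = α * d₂ G M μ) : IsCocycleWithClass β c := by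
  obtain ⟨hα, rfl⟩ := h
  refine ⟨hβ, QuotientGroup.eq.mpr ?_⟩
  rw [Subgroup.mem_subgroupOf]
  refine ⟨μ⁻¹, ?_⟩
  rw [map_inv]
  change _ = β⁻¹ * α
  rw [hμ, mul_inv, mul_comm α⁻¹, inv_mul_cancel_right]

namespace GradedFusion

section Independence

variable {k : Type w} [Field k] {C : Type u} [Category.{v} C] [Abelian C]
    [Linear k C] [MonoidalCategory C] [MonoidalPreadditive C] [MonoidalLinear k C]
    [RigidCategory C] [IsFusionCategory k C] {G : Type x} [Group G] {γ : Grading C G}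

lemma relDet_change {X Y M : C} (a a' : X ≅ M) (b b' : Y ≅ M) (φ : X ≅ Y) :
    relDet k a' b' φ =
      (relDet k a a' (Iso.refl X))⁻¹ * relDet k a b φ * relDet k b b' (Iso.refl Y) := by
  rw [mul_assoc, eq_inv_mul_iff_mul_eq, ← relDet_trans, ← relDet_trans, Iso.refl_trans,
    Iso.trans_refl]

namespace Identification

variable (t t' : Identification k γ) (f g h : G)

lemma left_eq : t.left f g h =
    whiskerRightCopies (t f g) (regularObj k γ h) ≪≫ copiesIso _ (t (f * g) h) := by
  rw [whiskerRightCopies, Iso.trans_assoc]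
  rfl

lemma right_eq (p : copies (trivialDim k γ) (copies (trivialDim k γ)
      (regularObj k γ (f * (g * h)))) =
      copies (trivialDim k γ) (copies (trivialDim k γ) (regularObj k γ (f * g * h)))) :
    t.right f g h = (whiskerLeftCopies (regularObj k γ f) (t g h) ≪≫
      copiesIso _ (t f (g * h))) ≪≫ copiesSwap _ _ _ ≪≫ eqToIso p := by
  rw [whiskerLeftCopies, Iso.trans_assoc, Iso.trans_assoc]
  rfl

variable [IsAlgClosed k]

/-- Replacing `t` by `t'` changes the identification of the source of the associator by an
automorphism whose determinant is computed in two steps, one for each of the two factors of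
`left`. -/
lemma relDet_left (hC : IsIntegralCategory k C) (hγ : γ.Faithful) :
    relDet k (t.left f g h) (t'.left f g h) (Iso.refl _) =
      relDet k (t f g) (t' f g) (Iso.refl _) ^ trivialDim k γ *
        relDet k (t (f * g) h) (t' (f * g) h) (Iso.refl _) ^ trivialDim k γ := by
  rw [left_eq, left_eq, ← relDet_copies hC (whiskerRightCopies (t' f g) (regularObj k γ h))
    (whiskerRightCopies (t' f g) (regularObj k γ h)) (Iso.refl _) (Iso.refl _) (by simp)]
  have h1 := relDet_whiskerRight hC (t f g) (t' f g) (Iso.refl _) (regularObj k γ h)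
  rw [dim_regularObj γ hC hγ] at h1
  rw [← h1, ← relDet_trans_iso _ _ (rightDistributor (fun _ => regularObj k γ (f * g))
    (regularObj k γ h) ≪≫ copiesIso _ (t (f * g) h)), ← Iso.trans_assoc, ← Iso.trans_assoc]
  refine Eq.trans ?_ (relDet_trans _ _ _ _ _)
  congr 1
  ext
  simp

lemma relDet_right (hC : IsIntegralCategory k C) (hγ : γ.Faithful) :
    relDet k (t.right f g h) (t'.right f g h) (Iso.refl _) =
      relDet k (t g h) (t' g h) (Iso.refl _) ^ trivialDim k γ *
        relDet k (t f (g * h)) (t' f (g * h)) (Iso.refl _) ^ trivialDim k γ := by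
  rw [right_eq _ _ _ _ (by rw [mul_assoc]), right_eq _ _ _ _ (by rw [mul_assoc]),
    relDet_trans_iso, ← relDet_copies hC (whiskerLeftCopies (regularObj k γ f) (t' g h))
    (whiskerLeftCopies (regularObj k γ f) (t' g h)) (Iso.refl _) (Iso.refl _) (by simp)]
  have h1 := relDet_whiskerLeft hC (t g h) (t' g h) (Iso.refl _) (regularObj k γ f)
  rw [dim_regularObj γ hC hγ] at h1
  rw [← h1, ← relDet_trans_iso _ _ (leftDistributor (regularObj k γ f)
    (fun _ => regularObj k γ (g * h)) ≪≫ copiesIso _ (t f (g * h))), ← Iso.trans_assoc,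
    ← Iso.trans_assoc]
  refine Eq.trans ?_ (relDet_trans _ _ _ _ _)
  congr 1
  ext
  simp

/-- Changing the identifications changes `alpha` by the coboundary of the determinants of the
changes. -/
theorem alpha_eq_mul_d₂ (hC : IsIntegralCategory k C) (hγ : γ.Faithful) :
    t'.alpha = t.alpha * d₂ G kˣ fun f g =>
      (relDet k (t f g) (t' f g) (Iso.refl _) ^ trivialDim k γ) ^ trivialDim k γ := by
  funext f g h
  change relDet k (t'.left f g h) (t'.right f g h) (α_ _ _ _) ^ _ =
    relDet k (t.left f g h) (t.right f g h) (α_ _ _ _) ^ _ * (_ * _⁻¹ * _ * _⁻¹)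
  rw [relDet_change (t.left f g h) (t'.left f g h) (t.right f g h) (t'.right f g h),
    relDet_left _ _ _ _ _ hC hγ, relDet_right _ _ _ _ _ hC hγ]
  simp only [mul_inv, mul_pow, inv_pow]
  ac_rfl

theorem isCocycleWithClass_of_isCocycleWithClass (hC : IsIntegralCategory k C) (hγ : γ.Faithful)
    {c : H3 G kˣ} (hc : IsCocycleWithClass t.alpha c) : IsCocycleWithClass t'.alpha c :=
  hc.mul_d₂ (t'.alpha_mem_Z3 hC hγ) _ (t.alpha_eq_mul_d₂ t' hC hγ)

end Identification

end Independence

/-! ### Transport along equivalences -/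

section SimpleMap

variable {C : Type u} [Category.{v} C] [HasZeroMorphisms C]
    {C' : Type u'} [Category.{v'} C'] [HasZeroMorphisms C'] (F : C ⥤ C') [F.IsEquivalence]

lemma simple_obj (S : C) [Simple S] : Simple (F.obj S) where
  mono_isIso_iff_nonzero {Y} f _ := by
    let e := F.objObjPreimageIso Y
    obtain ⟨g, hg⟩ := F.map_surjective (e.hom ≫ f)
    have : Mono (F.map g) := hg ▸ mono_comp _ _
    have : Mono g := F.mono_of_mono_map this
    have h1 : IsIso f ↔ IsIso g := by
      rw [← isIso_iff_of_reflects_iso g F, hg, isIso_comp_left_iff]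
    rw [h1, Simple.mono_isIso_iff_nonzero g, not_iff_not, ← F.map_eq_zero_iff, hg]
    exact ⟨fun h => by simpa using e.inv ≫= h, fun h => by rw [h, comp_zero]⟩

lemma simple_of_simple_obj (S : C) [Simple (F.obj S)] : Simple S where
  mono_isIso_iff_nonzero f _ := by
    rw [← isIso_iff_of_reflects_iso f F, Simple.mono_isIso_iff_nonzero (F.map f), not_iff_not,
      F.map_eq_zero_iff]

lemma SimpleClass.exists_iso_map (V : SimpleClass C) :
    ∃ V' : SimpleClass C', Nonempty (F.obj V.rep ≅ V'.rep) := by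
  have := simple_obj F V.rep
  exact ⟨_, SimpleClass.nonempty_iso_rep _⟩

/-- The bijection between the simple classes of equivalent categories. -/
def simpleClassMap (V : SimpleClass C) : SimpleClass C' := (SimpleClass.exists_iso_map F V).choose

/-- The image of a simple object represents the image of its class. -/
def simpleClassMapIso (V : SimpleClass C) : F.obj V.rep ≅ (simpleClassMap F V).rep :=
  (SimpleClass.exists_iso_map F V).choose_spec.some

lemma simpleClassMap_bijective : Function.Bijective (simpleClassMap F) := by
  constructor
  · intro V W h
    exact SimpleClass.eq_of_iso (F.preimageIso
      (simpleClassMapIso F V ≪≫ eqToIso (by rw [h]) ≪≫ (simpleClassMapIso F W).symm))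
  · intro V'
    let e := F.objObjPreimageIso V'.rep
    have : Simple (F.obj (F.objPreimage V'.rep)) := Simple.of_iso e
    have := simple_of_simple_obj F (F.objPreimage V'.rep)
    obtain ⟨s⟩ := SimpleClass.nonempty_iso_rep (F.objPreimage V'.rep)
    exact ⟨SimpleClass.mk (F.objPreimage V'.rep), SimpleClass.eq_of_iso
      ((simpleClassMapIso F _).symm ≪≫ F.mapIso s.symm ≪≫ e)⟩

end SimpleMap

section Transport

variable {k : Type w} [Field k] {C : Type u} [Category.{v} C] [Abelian C]
    [Linear k C] [MonoidalCategory C] [MonoidalPreadditive C] [MonoidalLinear k C]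
    [RigidCategory C] [IsFusionCategory k C]
    {C' : Type u'} [Category.{v'} C'] [Abelian C']
    [Linear k C'] [MonoidalCategory C'] [MonoidalPreadditive C'] [MonoidalLinear k C']
    [RigidCategory C'] [IsFusionCategory k C']
    (F : C ⥤ C') [F.Additive] [F.Linear k] [F.IsEquivalence]

lemma mult_map (Z : SimpleClass C) (X : C) :
    mult k (simpleClassMap F Z) (F.obj X) = mult k Z X := by
  rw [mult, ← finrank_hom_congr k (simpleClassMapIso F Z) (Iso.refl _)]
  exact (LinearEquiv.finrank_eq (LinearEquiv.ofBijective
    (F.mapLinearMap k : (Z.rep ⟶ X) →ₗ[k] _) ⟨F.map_injective, F.map_surjective⟩)).symm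

variable [IsAlgClosed k]

section Monoidal

variable [F.Monoidal]

lemma fpdim_map (X : C) : fpdim k (F.obj X) = fpdim k X := by
  have := IsFusionCategory.finite_simpleClass k (C := C)
  have := Fintype.ofFinite (SimpleClass C)
  have := IsFusionCategory.finite_simpleClass k (C := C')
  have := Fintype.ofFinite (SimpleClass C')
  have : Nonempty (SimpleClass C) := ⟨unitClass k⟩
  obtain ⟨v, hv, h⟩ := exists_fusionMatrix_mulVec_eq k (C := C')
  rw [fpdim_eq_sSup k X, (isGreatest_eigenvalue_of_pos_eigenvector (N := fusionMatrix k X)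
    (v := v ∘ simpleClassMap F) (r := fpdim k (F.obj X)) (fun _ _ => Nat.cast_nonneg _)
    (fun _ => hv _) ?_).csSup_eq]
  funext Z
  refine Eq.trans ?_ (congrFun (h (F.obj X)) (simpleClassMap F Z))
  refine Fintype.sum_bijective (simpleClassMap F) (simpleClassMap_bijective F) _ _ fun Y => ?_
  change (mult k Z (X ⊗ Y.rep) : ℝ) * v (simpleClassMap F Y) =
    (mult k (simpleClassMap F Z) (F.obj X ⊗ (simpleClassMap F Y).rep) : ℝ) *
      v (simpleClassMap F Y)
  rw [← mult_congr k (simpleClassMap F Z)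
    (whiskerLeftIso (F.obj X) (simpleClassMapIso F Y)),
    mult_congr k (simpleClassMap F Z) (Functor.Monoidal.μIso F X Y.rep), mult_map]

lemma dim_map (X : C) : dim k (F.obj X) = dim k X := by
  rw [dim, dim, fpdim_map]

lemma isIntegralCategory_of_equivalence (F : C ⥤ C') [F.Additive] [F.Linear k] [F.IsEquivalence]
    [F.Monoidal] (hC : IsIntegralCategory k C) :
    IsIntegralCategory k C' := fun X => by
  rw [← fpdim_congr k (F.objObjPreimageIso X), fpdim_map]
  exact hC _

variable {G : Type x} [Group G] {γ : Grading C G} {γ' : Grading C' G}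

lemma deg_simpleClassMap (hF : PreservesGrading γ γ' F) (V : SimpleClass C) :
    γ'.deg (simpleClassMap F V) = γ.deg V :=
  hF V _ ⟨simpleClassMapIso F V⟩

lemma faithful_of_preservesGrading (hF : PreservesGrading γ γ' F) (hγ : γ.Faithful) :
    γ'.Faithful := fun g => by
  obtain ⟨V, rfl⟩ := hγ g
  exact ⟨_, deg_simpleClassMap F hF V⟩

lemma nonempty_regularObj_iso_map (hF : PreservesGrading γ γ' F) (g : G) :
    Nonempty (regularObj k γ' g ≅ F.obj (regularObj k γ g)) := by
  classical
  refine nonempty_iso_of_mult_eq k fun Z' => ?_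
  obtain ⟨Z, rfl⟩ := (simpleClassMap_bijective F).2 Z'
  rw [mult_map, mult_regularObj, mult_regularObj, deg_simpleClassMap F hF,
    ← dim_congr k (simpleClassMapIso F Z), dim_map]

lemma trivialDim_map (hC : IsIntegralCategory k C) (hF : PreservesGrading γ γ' F) :
    trivialDim k γ = trivialDim k γ' := by
  obtain ⟨e⟩ := nonempty_regularObj_iso_map (k := k) F hF 1
  rw [← dim_regularObj_one γ hC, ← dim_regularObj_one γ' (isIntegralCategory_of_equivalence F hC),
    dim_congr k e, dim_map]

end Monoidal

end Transport

section MapCopies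

variable {C : Type u} [Category.{v} C] [Abelian C] {C' : Type u'} [Category.{v'} C'] [Abelian C']
    (F : C ⥤ C') [F.Additive]

/-- An additive functor commutes with multiple copies. The equation `m = n` allows for numbers of
copies that are only propositionally equal. -/
def mapCopies {m n : ℕ} (h : m = n) (X : C) : F.obj (copies m X) ≅ copies n (F.obj X) where
  hom := biproduct.lift fun j => F.map (biproduct.π (fun _ : Fin m => X) (Fin.cast h.symm j))
  inv := biproduct.desc fun j => F.map (biproduct.ι (fun _ : Fin m => X) (Fin.cast h.symm j))
  hom_inv_id := by
    subst h
    simp only [Fin.cast_eq_self, biproduct.lift_desc, ← F.map_comp, ← F.map_sum,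
      biproduct.total, F.map_id]
  inv_hom_id := by
    subst h
    apply biproduct.hom_ext'
    intro i
    apply biproduct.hom_ext
    intro j
    simp only [Fin.cast_eq_self, biproduct.ι_desc_assoc, Category.assoc, biproduct.lift_π,
      Category.comp_id, ← F.map_comp]
    by_cases hij : i = j
    · subst hij
      simp
    · rw [biproduct.ι_π_ne _ hij, biproduct.ι_π_ne _ hij, F.map_zero]

@[simp]
lemma mapCopies_hom_π {m n : ℕ} (h : m = n) (X : C) (j : Fin n) :
    (mapCopies F h X).hom ≫ biproduct.π (fun _ : Fin n => F.obj X) j =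
      F.map (biproduct.π (fun _ : Fin m => X) (Fin.cast h.symm j)) := by
  simp [mapCopies]

@[simp]
lemma mapCopies_hom_π_assoc {m n : ℕ} (h : m = n) (X : C) (j : Fin n) {Y : C'}
    (f : F.obj X ⟶ Y) :
    (mapCopies F h X).hom ≫ biproduct.π (fun _ : Fin n => F.obj X) j ≫ f =
      F.map (biproduct.π _ (Fin.cast h.symm j)) ≫ f := by
  rw [← Category.assoc, mapCopies_hom_π]

end MapCopies

section TransportIdentification

variable {k : Type w} [Field k] {C : Type u} [Category.{v} C] [Abelian C]
    [Linear k C] [MonoidalCategory C] [MonoidalPreadditive C] [MonoidalLinear k C]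
    [RigidCategory C] [IsFusionCategory k C]
    {C' : Type u'} [Category.{v'} C'] [Abelian C']
    [Linear k C'] [MonoidalCategory C'] [MonoidalPreadditive C'] [MonoidalLinear k C']
    [RigidCategory C'] [IsFusionCategory k C']
    (F : C ⥤ C') [F.Additive] [F.Monoidal]
    {G : Type x} [Group G] {γ : Grading C G} {γ' : Grading C' G}
    (e : ∀ g : G, regularObj k γ' g ≅ F.obj (regularObj k γ g))
    (hD : trivialDim k γ = trivialDim k γ')

open Functor.LaxMonoidal Functor.Monoidal

namespace Identification

variable (t : Identification k γ) (f g h : G)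

/-- The identification `t` transported along a monoidal functor `F`, by means of isomorphisms
`R'_g ≅ F R_g`. -/
def transport : Identification k γ' := fun f g =>
  (e f ⊗ᵢ e g) ≪≫ μIso F _ _ ≪≫ F.mapIso (t f g) ≪≫ mapCopies F hD _ ≪≫
    copiesIso _ (e (f * g)).symm

lemma transport_comp (i : Fin (trivialDim k γ')) :
    (t.transport F e hD).comp f g i = ((e f).hom ⊗ₘ (e g).hom) ≫ μ F _ _ ≫
      F.map (t.comp f g (Fin.cast hD.symm i)) ≫ (e (f * g)).inv := by
  simp [transport, comp]

/-- The comparison `F (D² R_g) ≅ D² R'_g`. -/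
def mapCopiesCopies (g : G) :
    F.obj (copies (trivialDim k γ) (copies (trivialDim k γ) (regularObj k γ g))) ≅
      copies (trivialDim k γ') (copies (trivialDim k γ') (regularObj k γ' g)) :=
  mapCopies F hD _ ≪≫ copiesIso _ (mapCopies F hD _ ≪≫ copiesIso _ (e g).symm)

lemma map_mapCopiesCopies {A : C}
    (φ : A ⟶ copies (trivialDim k γ) (copies (trivialDim k γ) (regularObj k γ g)))
    (i j : Fin (trivialDim k γ')) :
    F.map φ ≫ (mapCopiesCopies F e hD g).hom ≫ biproduct.π _ i ≫ biproduct.π _ j =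
      F.map (φ ≫ biproduct.π _ (Fin.cast hD.symm i) ≫ biproduct.π _ (Fin.cast hD.symm j)) ≫
        (e g).inv := by
  simp [mapCopiesCopies]

lemma eqToHom_inv {g g' : G} (h : g = g')
    (p : F.obj (regularObj k γ g) = F.obj (regularObj k γ g')) :
    eqToHom p ≫ (e g').inv = (e g).inv ≫ eqToHom (by rw [h]) := by
  subst h
  simp

/-- The comparison `(R'_f ⊗ R'_g) ⊗ R'_h ≅ F ((R_f ⊗ R_g) ⊗ R_h)`. -/
def transportLeft : (regularObj k γ' f ⊗ regularObj k γ' g) ⊗ regularObj k γ' h ≅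
    F.obj ((regularObj k γ f ⊗ regularObj k γ g) ⊗ regularObj k γ h) :=
  (((e f ⊗ᵢ e g) ≪≫ μIso F _ _) ⊗ᵢ e h) ≪≫ μIso F _ _

/-- The comparison `R'_f ⊗ (R'_g ⊗ R'_h) ≅ F (R_f ⊗ (R_g ⊗ R_h))`. -/
def transportRight : regularObj k γ' f ⊗ (regularObj k γ' g ⊗ regularObj k γ' h) ≅
    F.obj (regularObj k γ f ⊗ (regularObj k γ g ⊗ regularObj k γ h)) :=
  (e f ⊗ᵢ ((e g ⊗ᵢ e h) ≪≫ μIso F _ _)) ≪≫ μIso F _ _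

lemma associator_transportRight :
    (α_ _ _ _).hom ≫ (transportRight F e f g h).hom =
      (transportLeft F e f g h).hom ≫ F.map (α_ _ _ _).hom := by
  have h1 : ((e f).hom ⊗ₘ (e g).hom) ≫ μ F _ _ ⊗ₘ (e h).hom =
      (((e f).hom ⊗ₘ (e g).hom) ⊗ₘ (e h).hom) ≫ μ F _ _ ▷ _ := by
    rw [← tensorHom_id, tensorHom_comp_tensorHom, Category.comp_id]
  have h2 : (e f).hom ⊗ₘ ((e g).hom ⊗ₘ (e h).hom) ≫ μ F _ _ =
      ((e f).hom ⊗ₘ ((e g).hom ⊗ₘ (e h).hom)) ≫ _ ◁ μ F _ _ := by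
    rw [← id_tensorHom, tensorHom_comp_tensorHom, Category.comp_id]
  simp only [transportLeft, transportRight, Iso.trans_hom, tensorIso_hom, μIso_hom, Category.assoc]
  rw [h1, h2, Category.assoc, Category.assoc, associativity, associator_naturality_assoc]

lemma transport_left : (t.transport F e hD).left f g h =
    transportLeft F e f g h ≪≫ F.mapIso (t.left f g h) ≪≫ mapCopiesCopies F e hD _ := by
  ext1
  refine copies_hom_ext₂ fun i j => ?_
  rw [left_hom_π_π, transport_comp, transport_comp]
  simp only [Iso.trans_hom, Category.assoc, Functor.mapIso_hom]
  rw [map_mapCopiesCopies, left_hom_π_π]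
  simp [transportLeft, MonoidalCategory.tensorHom_def, ← whisker_exchange_assoc]

lemma transport_right : (t.transport F e hD).right f g h =
    transportRight F e f g h ≪≫ F.mapIso (t.right f g h) ≪≫ mapCopiesCopies F e hD _ := by
  ext1
  refine copies_hom_ext₂ fun i j => ?_
  rw [right_hom_π_π, transport_comp, transport_comp]
  simp only [Iso.trans_hom, Category.assoc, Functor.mapIso_hom]
  rw [map_mapCopiesCopies, right_hom_π_π]
  simp only [F.map_comp, eqToHom_map, Category.assoc]
  rw [eqToHom_inv F e (mul_assoc f g h).symm]
  simp [transportRight, tensorHom_def', whisker_exchange_assoc]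

theorem transport_alpha [IsAlgClosed k] [F.Linear k] [F.IsEquivalence]
    (hC : IsIntegralCategory k C) : (t.transport F e hD).alpha = t.alpha := by
  funext f g h
  have h1 := autDet_mapIso (isIntegralCategory_of_equivalence F hC) F 1
    (fun V => by rw [dim_map, one_mul]) (t.assocAut f g h)
  rw [pow_one] at h1
  suffices h2 : autDet k ((t.transport F e hD).assocAut f g h) = autDet k (t.assocAut f g h) by
    rw [alpha, alpha, h2]
    exact congrArg _ hD.symm
  rw [← h1, ← autDet_conj (mapCopiesCopies F e hD _), assocAut, assocAut, transport_left,
    transport_right]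
  congr 1
  ext1
  have := associator_transportRight F e f g h
  rw [← Iso.inv_comp_eq] at this
  simp only [Iso.trans_hom, Iso.symm_hom, Iso.trans_inv, Category.assoc, Functor.mapIso_hom,
    Functor.mapIso_inv, F.map_comp]
  rw [← reassoc_of% this]

end Identification

end TransportIdentification

end GradedFusion

end

theorem proposition4p2 {k : Type w} [Field k] [IsAlgClosed k] [CharZero k]
    {G : Type x} [Group G] [Finite G]
    {C : Type u} [Category.{v} C] [Abelian C] [Linear k C] [MonoidalCategory C]
    [MonoidalPreadditive C] [MonoidalLinear k C] [RigidCategory C] [IsFusionCategory k C]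
    (hC : IsIntegralCategory k C) (γ : Grading C G) (hγ : γ.Faithful) :
    (∀ f g : G, Nonempty (regularObj k γ f ⊗ regularObj k γ g ≅
      copies (trivialDim k γ) (regularObj k γ (f * g)))) ∧
    ∃ c : H3 G kˣ,
      (∀ t : Identification k γ, IsCocycleWithClass t.alpha c) ∧
      ∀ (C' : Type u') [Category.{v'} C'] [Abelian C'] [Linear k C'] [MonoidalCategory C']
        [MonoidalPreadditive C'] [MonoidalLinear k C'] [RigidCategory C'] [IsFusionCategory k C']
        (γ' : Grading C' G) (F : C ⥤ C') [F.Monoidal] [F.Additive] [F.Linear k]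
        [F.IsEquivalence], PreservesGrading γ γ' F →
        (∀ f g : G, Nonempty (regularObj k γ' f ⊗ regularObj k γ' g ≅
          copies (trivialDim k γ') (regularObj k γ' (f * g)))) ∧
        ∀ t' : Identification k γ', IsCocycleWithClass t'.alpha c := by
  have hexists := nonempty_regularObj_tensor_iso γ hC hγ
  let t₀ : Identification k γ := fun f g => (hexists f g).some
  refine ⟨hexists, _, fun t => Identification.isCocycleWithClass_of_isCocycleWithClass t₀ t hC hγ
    ⟨t₀.alpha_mem_Z3 hC hγ, rfl⟩, ?_⟩
  intro C' _ _ _ _ _ _ _ _ γ' F _ _ _ _ hF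
  have hC' := isIntegralCategory_of_equivalence F hC
  have hγ' := faithful_of_preservesGrading F hF hγ
  refine ⟨nonempty_regularObj_tensor_iso γ' hC' hγ', fun t' => ?_⟩
  -- The identifications transported from `C` represent the same class, and in `C'` the class does
  -- not depend on the identifications.
  let e g := (nonempty_regularObj_iso_map (k := k) F hF g).some
  refine Identification.isCocycleWithClass_of_isCocycleWithClass
    (t₀.transport F e (trivialDim_map F hC hF)) t' hC' hγ' ?_
  rw [Identification.transport_alpha F e _ t₀ hC]
  exact ⟨t₀.alpha_mem_Z3 hC hγ, rfl⟩
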